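/- Let $\mathcal H$ be a complex Hilbert space (inner products linear in the second variable), write $|x\rangle\langle y|$ for the operator $v\mapsto\langle y,v\rangle x$, and let the $\sigma$-weak topology on $\mathcal B(\mathcal H)$ be the one generated by the functionals $A\mapsto\sum_n\langle x_n,Ay_n\rangle$ with $\sum_n\|x_n\|^2<\infty$, $\sum_n\|y_n\|^2<\infty$. Let $(T_t)_{t\ge0}$ be a quantum Markov semigroup on $\mathcal B(\mathcal H)$, i.e. a family of $\sigma$-weakly continuous completely positive linear maps with $T_0=\mathrm{id}$, $T_{t+s}=T_tT_s$, $T_t(1)=1$ and $t\mapsto T_t(A)$ $\sigma$-weakly continuous for every $A$. Let $L$ be its generator: $D(L)$ is the set of $A$ for which $\frac1t(T_tA-A)$ converges $\sigma$-weakly as $t\downarrow0$, and $L(A)$ is the limit. Let $$\mathcal A=\{A\in D(L): A^*A\in D(L),\ AA^*\in D(L)\}$$ be the domain algebra of $L$ (the largest $^*$-subalgebra of $\mathcal B(\mathcal H)$ contained in $D(L)$). Let $R\in D(L)$ be a nonzero positive finite rank operator and let $h$ be an associate vector of $R$: for some spectral decomposition $R=\sum_{s=1}^m t_s'|k_s'\rangle\langle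 k_s'|$ with $(k'_s)$ orthonormal and $t'_s>0$, put $t=\sum_s t'_s$ and $k_s=\sqrt t\,k'_s$; then $h=\sum_{s=1}^m\|k_s\|^{-2}k_s$. Assume $|Rh\rangle\langle Rh|\in D(L)$ and put $U=\{x\in\mathcal H: |x\rangle\langle Rh|\in\mathcal A\}$. Assume that $U$ is norm dense in $\mathcal H$ and that there is $C>0$ with $$\|L(|x\rangle\langle Rh|)h\|\le C\|x\|\qquad\text{for all }x\in U.$$ Then $\mathcal A$ is a unital $^*$-subalgebra of $\mathcal B(\mathcal H)$, and there exist a bounded operator $G\in\mathcal B(\mathcal H)$, a Hilbert space $\mathcal K$, a bounded operator $V:\mathcal H\to\mathcal K$ and a unital norm-continuous $^*$-homomorphism $\pi:\mathcal A\to\mathcal B(\mathcal K)$ such that $$L(A)=V^*\pi(A)V+GA+AG^*\qquad\text{for all }A\in\mathcal A.$$ Moreover, the map $\mathcal A\to\mathcal B(\mathcal H)$, $A\mapsto GA+AG^*$, is continuous for the $\sigma$-weak topologies, and the map $\varphi:\mathcal A\to\mathcal B(\mathcal H)$, $\varphi(A)=V^*\pi(A)V$, is $\sigma$-weakly closable: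 if a net $(A_\lambda)$ in $\mathcal A$ satisfies $A_\lambda\to0$ and $\varphi(A_\lambda)\to B\in\mathcal B(\mathcal H)$ $\sigma$-weakly, then $B=0$. -/

import Mathlib

open scoped ComplexInnerProductSpace CStarAlgebra Topology NNReal InnerProduct
open Filter ContinuousLinearMap

universe u

section SigmaWeak

/-- The `σ`-weak (ultraweak) topology on `B(H)`: the coarsest topology for which all functionals
`A ↦ ∑ₙ ⟨xₙ, A yₙ⟩` with `∑ₙ ‖xₙ‖² < ∞` and `∑ₙ ‖yₙ‖² < ∞` are continuous. These are precisely the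
functionals `A ↦ tr (R A)` with `R` of trace class, i.e. the predual of `B(H)`.
The inner product is linear in the second variable. -/
@[reducible]
noncomputable def sigmaWeakTopology (H : Type u) [NormedAddCommGroup H] [InnerProductSpace ℂ H] :
    TopologicalSpace (H →L[ℂ] H) :=
  ⨅ (x : ℕ → H) (y : ℕ → H) (_ : Summable fun n => ‖x n‖ ^ 2) (_ : Summable fun n => ‖y n‖ ^ 2),
    TopologicalSpace.induced (fun A : H →L[ℂ] H => ∑' n, ⟪x n, A (y n)⟫) inferInstance

variable {H : Type u} [NormedAddCommGroup H] [InnerProductSpace ℂ H]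

/-- Convergence of a family of operators, along a filter, in the `σ`-weak topology. -/
def SigmaWeakTendsto {ι : Type*} (f : ι → (H →L[ℂ] H)) (l : Filter ι) (B : H →L[ℂ] H) : Prop :=
  Tendsto f l (@nhds _ (sigmaWeakTopology H) B)

theorem sigmaWeakTendsto_iff {ι : Type*} {f : ι → (H →L[ℂ] H)} {l : Filter ι} {B : H →L[ℂ] H} :
    SigmaWeakTendsto f l B ↔ ∀ x y : ℕ → H, (Summable fun n => ‖x n‖ ^ 2) →
      (Summable fun n => ‖y n‖ ^ 2) →
      Tendsto (fun i => ∑' n, ⟪x n, f i (y n)⟫) l (𝓝 (∑' n, ⟪x n, B (y n)⟫)) := by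
  simp only [SigmaWeakTendsto, nhds_iInf, tendsto_iInf, nhds_induced,
    tendsto_comap_iff]
  rfl

theorem summable_inner_apply {x y : ℕ → H} (hx : Summable fun n => ‖x n‖ ^ 2)
    (hy : Summable fun n => ‖y n‖ ^ 2) (A : H →L[ℂ] H) : Summable fun n => ⟪x n, A (y n)⟫ := by
  refine Summable.of_norm_bounded (g := fun n => ‖A‖ * (‖x n‖ ^ 2 + ‖y n‖ ^ 2))
    ((hx.add hy).mul_left _) fun n => ?_
  have h1 := norm_inner_le_norm (𝕜 := ℂ) (x n) (A (y n))
  have h2 : ‖x n‖ * ‖A (y n)‖ ≤ ‖x n‖ * (‖A‖ * ‖y n‖) := by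
    gcongr
    exact A.le_opNorm _
  have h3 : ‖A‖ * (‖x n‖ * ‖y n‖) ≤ ‖A‖ * (‖x n‖ ^ 2 + ‖y n‖ ^ 2) := by
    gcongr
    nlinarith [sq_nonneg (‖x n‖ - ‖y n‖), sq_nonneg (‖x n‖), sq_nonneg (‖y n‖)]
  linarith

theorem SigmaWeakTendsto.add {ι : Type*} {f g : ι → (H →L[ℂ] H)} {l : Filter ι}
    {B C : H →L[ℂ] H} (hf : SigmaWeakTendsto f l B) (hg : SigmaWeakTendsto g l C) :
    SigmaWeakTendsto (fun i => f i + g i) l (B + C) := by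
  rw [sigmaWeakTendsto_iff] at *
  intro x y hx hy
  have := (hf x y hx hy).add (hg x y hx hy)
  simpa only [add_apply, inner_add_right, (summable_inner_apply hx hy _).tsum_add
    (summable_inner_apply hx hy _)] using this

theorem SigmaWeakTendsto.const_smul {ι : Type*} {f : ι → (H →L[ℂ] H)} {l : Filter ι}
    {B : H →L[ℂ] H} (hf : SigmaWeakTendsto f l B) (c : ℂ) :
    SigmaWeakTendsto (fun i => c • f i) l (c • B) := by
  rw [sigmaWeakTendsto_iff] at *
  intro x y hx hy
  have := (hf x y hx hy).const_mul c
  simpa only [smul_apply, inner_smul_right, tsum_mul_left] using this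

/-- The `σ`-weak topology is Hausdorff: limits are unique. -/
theorem SigmaWeakTendsto.unique {ι : Type*} {f : ι → (H →L[ℂ] H)} {l : Filter ι} [l.NeBot]
    {B C : H →L[ℂ] H} (hB : SigmaWeakTendsto f l B) (hC : SigmaWeakTendsto f l C) : B = C := by
  rw [sigmaWeakTendsto_iff] at *
  ext v
  refine ext_inner_left ℂ fun w => ?_
  have hs : ∀ z : H, Summable fun n : ℕ => ‖(if n = 0 then z else 0 : H)‖ ^ 2 := fun z =>
    summable_of_ne_finset_zero (s := {0}) fun n hn => by
      have : n ≠ 0 := by simpa using hn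
      simp [this]
  have key := tendsto_nhds_unique (hB _ _ (hs w) (hs v)) (hC _ _ (hs w) (hs v))
  have hD : ∀ D : H →L[ℂ] H,
      (∑' n : ℕ, ⟪(if n = 0 then w else 0 : H), D (if n = 0 then v else 0)⟫) = ⟪w, D v⟫ := by
    intro D
    rw [tsum_eq_single 0 fun n hn => by simp [hn]]
    simp
  rwa [hD, hD] at key

/-- A map `φ` from a set `𝒟` of bounded operators to `B(H)` is `σ`-weakly-`σ`-weakly closable:
whenever a net in `𝒟` converges `σ`-weakly to `0` and its image under `φ` converges `σ`-weakly
to `B`, then `B = 0`. (Nets in `𝒟` are replaced by proper filters on `𝒟`.) -/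
def IsSigmaWeaklyClosable {𝒟 : Set (H →L[ℂ] H)} (φ : 𝒟 → (H →L[ℂ] H)) : Prop :=
  ∀ (l : Filter 𝒟) [l.NeBot] (B : H →L[ℂ] H),
    SigmaWeakTendsto (fun A : 𝒟 => (A : H →L[ℂ] H)) l 0 → SigmaWeakTendsto φ l B → B = 0

/-- A map from a set `𝒟` of bounded operators to `B(H)` is `σ`-weakly-`σ`-weakly continuous;
`𝒟` carries the topology induced by the `σ`-weak topology. -/
def IsSigmaWeaklyContinuous {𝒟 : Set (H →L[ℂ] H)} (φ : 𝒟 → (H →L[ℂ] H)) : Prop :=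
  @Continuous _ _ (TopologicalSpace.induced Subtype.val (sigmaWeakTopology H))
    (sigmaWeakTopology H) φ

end SigmaWeak

section QMS

/-- A quantum Markov semigroup on `B(H)`: a family `(T t)`, `t ≥ 0`, of `σ`-weakly continuous
completely positive linear maps on `B(H)` with `T 0 = id`, `T (t + s) = T t ∘ T s`, such that
`t ↦ T t A` is `σ`-weakly continuous for every `A`, and `T t 1 = 1`. -/
structure QuantumMarkovSemigroup (H : Type u) [NormedAddCommGroup H] [InnerProductSpace ℂ H]
    [CompleteSpace H] where
  /-- The map `T t`. -/
  T : ℝ≥0 → ((H →L[ℂ] H) →CP (H →L[ℂ] H))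
  sigmaWeak_continuous : ∀ t,
    @Continuous _ _ (sigmaWeakTopology H) (sigmaWeakTopology H) fun A => T t A
  map_time_zero : ∀ A, T 0 A = A
  map_time_add : ∀ t s A, T (t + s) A = T t (T s A)
  time_continuous : ∀ A, @Continuous _ _ inferInstance (sigmaWeakTopology H) fun t => T t A
  map_one : ∀ t, T t 1 = 1

namespace QuantumMarkovSemigroup

variable {H : Type u} [NormedAddCommGroup H] [InnerProductSpace ℂ H] [CompleteSpace H]
  (S : QuantumMarkovSemigroup H)

/-- `(T t A - A) / t` converges `σ`-weakly to `B` as `t ↓ 0`, i.e. `A ∈ D(L)` and `L A = B`. -/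
def HasGeneratorAt (A B : H →L[ℂ] H) : Prop :=
  SigmaWeakTendsto (fun t : ℝ≥0 => ((t : ℝ) : ℂ)⁻¹ • (S.T t A - A)) (𝓝[>] 0) B

variable {S}

theorem HasGeneratorAt.unique {A B C : H →L[ℂ] H} (hB : S.HasGeneratorAt A B)
    (hC : S.HasGeneratorAt A C) : B = C :=
  SigmaWeakTendsto.unique hB hC

theorem HasGeneratorAt.add {A A' B B' : H →L[ℂ] H} (h : S.HasGeneratorAt A B)
    (h' : S.HasGeneratorAt A' B') : S.HasGeneratorAt (A + A') (B + B') := by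
  have := SigmaWeakTendsto.add h h'
  simpa only [HasGeneratorAt, map_add, add_sub_add_comm, smul_add] using this

theorem HasGeneratorAt.smul {A B : H →L[ℂ] H} (h : S.HasGeneratorAt A B) (c : ℂ) :
    S.HasGeneratorAt (c • A) (c • B) := by
  have := SigmaWeakTendsto.const_smul h c
  simpa only [HasGeneratorAt, map_smul, ← smul_sub, smul_comm c] using this

theorem hasGeneratorAt_zero : S.HasGeneratorAt 0 0 := by
  simp only [HasGeneratorAt, map_zero, sub_zero, smul_zero]
  exact @tendsto_const_nhds _ (sigmaWeakTopology H) _ _ _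

variable (S)

/-- The generator `L` of the semigroup, as an unbounded operator on `B(H)`: its domain `D(L)`
consists of those `A` for which `(T t A - A) / t` converges `σ`-weakly as `t ↓ 0`, and `L A` is
the limit. -/
noncomputable def generator : (H →L[ℂ] H) →ₗ.[ℂ] (H →L[ℂ] H) where
  domain :=
    { carrier := {A | ∃ B, S.HasGeneratorAt A B}
      add_mem' := fun ⟨_, h⟩ ⟨_, h'⟩ => ⟨_, h.add h'⟩
      zero_mem' := ⟨0, hasGeneratorAt_zero⟩
      smul_mem' := fun c _ ⟨_, h⟩ => ⟨_, h.smul c⟩ }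
  toFun :=
    { toFun := fun A => A.2.choose
      map_add' := fun A A' =>
        (A + A').2.choose_spec.unique (A.2.choose_spec.add A'.2.choose_spec)
      map_smul' := fun c A => (c • A).2.choose_spec.unique (A.2.choose_spec.smul c) }

theorem generator_spec (A : S.generator.domain) : S.HasGeneratorAt A (S.generator A) :=
  A.2.choose_spec

/-- The domain algebra `𝒜 = {A ∈ D(L) : A* A ∈ D(L), A A* ∈ D(L)}` of the generator `L`. -/
def domainAlgebra : Set (H →L[ℂ] H) :=
  {A | A ∈ S.generator.domain ∧ adjoint A ∘L A ∈ S.generator.domain ∧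
    A ∘L adjoint A ∈ S.generator.domain}

/-- Every `*`-subalgebra contained in `D(L)` is contained in the domain algebra. -/
theorem subset_domainAlgebra (B : NonUnitalStarSubalgebra ℂ (H →L[ℂ] H))
    (hB : (B : Set (H →L[ℂ] H)) ⊆ S.generator.domain) :
    (B : Set (H →L[ℂ] H)) ⊆ S.domainAlgebra := fun _ hA =>
  ⟨hB hA, hB (mul_mem (star_mem hA) hA), hB (mul_mem hA (star_mem hA))⟩

/-- The set `U = {x ∈ H : |x⟩⟨k| ∈ 𝒜}`, where `|x⟩⟨k| v = ⟨k, v⟩ x`. -/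
def domainVectors (k : H) : Set H :=
  {x | InnerProductSpace.rankOne ℂ x k ∈ S.domainAlgebra}

theorem rankOne_mem_domain {k x : H} (hx : x ∈ S.domainVectors k) :
    InnerProductSpace.rankOne ℂ x k ∈ S.generator.domain :=
  hx.1

end QuantumMarkovSemigroup

/-- `h` is an associate vector of the positive finite rank operator `R`: for some spectral
decomposition `R = ∑ₛ t'ₛ |k'ₛ⟩⟨k'ₛ|` with `k'ₛ` orthonormal and `t'ₛ > 0`, one has
`h = ∑ₛ ‖kₛ‖⁻² kₛ`, where `kₛ = √t k'ₛ` and `t = ∑ₛ t'ₛ`. -/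
def IsAssociateVector {H : Type u} [NormedAddCommGroup H] [InnerProductSpace ℂ H]
    (R : H →L[ℂ] H) (h : H) : Prop :=
  ∃ (m : ℕ) (k' k : Fin m → H) (t' : Fin m → ℝ),
    Orthonormal ℂ k' ∧ (∀ s, 0 < t' s) ∧
    R = ∑ s, (t' s : ℂ) • InnerProductSpace.rankOne ℂ (k' s) (k' s) ∧
    (∀ s, k s = (Real.sqrt (∑ j, t' j) : ℂ) • k' s) ∧
    h = ∑ s, ((‖k s‖ ^ 2 : ℝ) : ℂ)⁻¹ • k s

end QMS

/-!
Since each `T t` is `σ`-weakly continuous, the generator `L` is `σ`-weakly closed and `D(L)` is the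
Favard class `{A | ‖T t A - A‖ = O(t)}`. For `A ∈ D(L)`, the condition `A* A ∈ D(L)` therefore says
that `‖T t (A* A) - (T t A)* (T t A)‖` is `O(t)`. Dilating `T t = V* π(·) V` with an isometry `V`
turns this norm into `‖(1 - V V*) π(A) V‖²`, the square of a seminorm which satisfies a Leibniz
inequality, so the domain algebra `𝒜` is a `*`-algebra.

As a derivative of completely positive maps, `L` is positive on families with `∑ᵢ aᵢ xᵢ = 0`. Put
`k = R h`, so that `⟨k, h⟩ = 1`, and define `G` by `G x = L(|x⟩⟨k|) h - (β / 2) x` with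
`β = ⟨L(|k⟩⟨k|) h, h⟩`. Appending the pair `(|u⟩⟨k|, -h)`, where `u = ∑ᵢ aᵢ xᵢ`, makes an arbitrary
family satisfy that constraint, and the form of `L` on the extended family is the form of
`A ↦ L A - G A - A G*` on the original one. This map is thus completely positive, and its
Stinespring dilation is `V* π(·) V`. It is a `σ`-weakly continuous perturbation of the closed
operator `L`, hence closable.
-/

section SesquilinearForms

variable {𝕜 H : Type*} [RCLike 𝕜] [NormedAddCommGroup H] [InnerProductSpace 𝕜 H] [CompleteSpace H]

/-- The bounded operator `B` with `⟨x, B y⟩ = φ x y`, where `φ` is a bounded sesquilinear form. -/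
noncomputable def operatorOfForm (φ : H →ₗ⋆[𝕜] H →ₗ[𝕜] 𝕜) {M : ℝ}
    (hM : ∀ x y, ‖φ x y‖ ≤ M * ‖x‖ * ‖y‖) : H →L[𝕜] H :=
  adjoint (InnerProductSpace.continuousLinearMapOfBilin (φ.mkContinuous₂ M hM))

theorem inner_operatorOfForm (φ : H →ₗ⋆[𝕜] H →ₗ[𝕜] 𝕜) {M : ℝ}
    (hM : ∀ x y, ‖φ x y‖ ≤ M * ‖x‖ * ‖y‖) (x y : H) :
    inner 𝕜 x (operatorOfForm φ hM y) = φ x y := by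
  rw [operatorOfForm, adjoint_inner_right, InnerProductSpace.continuousLinearMapOfBilin_apply,
    LinearMap.mkContinuous₂_apply]

end SesquilinearForms

section SigmaWeakFunctionals

variable {H : Type u} [NormedAddCommGroup H] [InnerProductSpace ℂ H]

theorem norm_inner_apply_le (A : H →L[ℂ] H) (x y : H) :
    ‖⟪x, A y⟫‖ ≤ ‖A‖ * (‖x‖ ^ 2 + ‖y‖ ^ 2) :=
  calc ‖⟪x, A y⟫‖ ≤ ‖x‖ * (‖A‖ * ‖y‖) :=
        (norm_inner_le_norm _ _).trans (by gcongr; exact A.le_opNorm _)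
    _ = ‖A‖ * (‖x‖ * ‖y‖) := by ring
    _ ≤ ‖A‖ * (‖x‖ ^ 2 + ‖y‖ ^ 2) := by
        gcongr
        nlinarith [sq_nonneg (‖x‖ - ‖y‖), sq_nonneg ‖x‖, sq_nonneg ‖y‖]

/-- The functional `A ↦ ∑ᵢ ⟨xᵢ, A yᵢ⟩` for square summable families `x` and `y`, which need not
be sequences. -/
noncomputable def vectorFunctional {ι : Type*} {x y : ι → H} (hx : Summable fun i => ‖x i‖ ^ 2)
    (hy : Summable fun i => ‖y i‖ ^ 2) : (H →L[ℂ] H) →ₗ[ℂ] ℂ :=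
  have hs (A : H →L[ℂ] H) : Summable fun i => ⟪x i, A (y i)⟫ :=
    .of_norm_bounded ((hx.add hy).mul_left ‖A‖) fun _ => norm_inner_apply_le A _ _
  { toFun A := ∑' i, ⟪x i, A (y i)⟫
    map_add' A B := by simp only [add_apply, inner_add_right, (hs A).tsum_add (hs B)]
    map_smul' c A := by
      simp only [smul_apply, inner_smul_right, tsum_mul_left, RingHom.id_apply, smul_eq_mul] }

theorem vectorFunctional_apply {ι : Type*} {x y : ι → H} (hx : Summable fun i => ‖x i‖ ^ 2)
    (hy : Summable fun i => ‖y i‖ ^ 2) (A : H →L[ℂ] H) :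
    vectorFunctional hx hy A = ∑' i, ⟪x i, A (y i)⟫ := rfl

theorem tendsto_vectorFunctional_of_bounded {κ ι : Type*} {x y : κ → H}
    (hx : Summable fun i => ‖x i‖ ^ 2) (hy : Summable fun i => ‖y i‖ ^ 2) {f : ι → (H →L[ℂ] H)}
    {l : Filter ι} {B : H →L[ℂ] H} {M : ℝ} (hM : ∀ᶠ i in l, ‖f i‖ ≤ M)
    (hf : ∀ x y, Tendsto (fun i => ⟪x, f i y⟫) l (𝓝 ⟪x, B y⟫)) :
    Tendsto (fun i => vectorFunctional hx hy (f i)) l (𝓝 (vectorFunctional hx hy B)) := by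
  refine tendsto_tsum_of_dominated_convergence
    (bound := fun n => M * (‖x n‖ ^ 2 + ‖y n‖ ^ 2)) ((hx.add hy).mul_left _) (fun n => hf _ _) ?_
  filter_upwards [hM] with i hi n
  exact (norm_inner_apply_le _ _ _).trans (by gcongr)

theorem sigmaWeakTendsto_of_bounded {ι : Type*} {f : ι → (H →L[ℂ] H)} {l : Filter ι}
    {B : H →L[ℂ] H} {M : ℝ} (hM : ∀ᶠ i in l, ‖f i‖ ≤ M)
    (hf : ∀ x y, Tendsto (fun i => ⟪x, f i y⟫) l (𝓝 ⟪x, B y⟫)) : SigmaWeakTendsto f l B :=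
  sigmaWeakTendsto_iff.2 fun _ _ hx hy => tendsto_vectorFunctional_of_bounded hx hy hM hf

/-- A complex function on `B(H)` is normal if it is continuous for the `σ`-weak topology. -/
def IsNormalFunctional (f : (H →L[ℂ] H) → ℂ) : Prop :=
  @Continuous _ _ (sigmaWeakTopology H) inferInstance f

namespace IsNormalFunctional

theorem tendsto {f : (H →L[ℂ] H) → ℂ} (hf : IsNormalFunctional f) {ι : Type*}
    {g : ι → (H →L[ℂ] H)} {l : Filter ι} {B : H →L[ℂ] H} (hg : SigmaWeakTendsto g l B) :
    Tendsto (fun i => f (g i)) l (𝓝 (f B)) :=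
  (@Continuous.tendsto _ _ (sigmaWeakTopology H) _ _ hf B).comp hg

theorem add {f g : (H →L[ℂ] H) → ℂ} (hf : IsNormalFunctional f) (hg : IsNormalFunctional g) :
    IsNormalFunctional fun A => f A + g A :=
  @Continuous.add _ _ _ _ _ (sigmaWeakTopology H) _ _ hf hg

theorem const_mul {f : (H →L[ℂ] H) → ℂ} (hf : IsNormalFunctional f) (c : ℂ) :
    IsNormalFunctional fun A => c * f A :=
  @Continuous.mul _ _ _ _ _ (sigmaWeakTopology H) _ _
    (@continuous_const _ _ (sigmaWeakTopology H) _ c) hf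

end IsNormalFunctional

theorem isNormalFunctional_tsum_inner {x y : ℕ → H} (hx : Summable fun n => ‖x n‖ ^ 2)
    (hy : Summable fun n => ‖y n‖ ^ 2) :
    IsNormalFunctional fun A : H →L[ℂ] H => ∑' n, ⟪x n, A (y n)⟫ :=
  continuous_iInf_dom (i := x) <| continuous_iInf_dom (i := y) <| continuous_iInf_dom (i := hx) <|
    continuous_iInf_dom (i := hy) continuous_induced_dom

theorem isNormalFunctional_vectorFunctional {ι : Type*} {x y : ι → H}
    (hx : Summable fun i => ‖x i‖ ^ 2) (hy : Summable fun i => ‖y i‖ ^ 2) :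
    IsNormalFunctional (vectorFunctional hx hy) := by
  -- Only countably many `x i` are nonzero, so the family can be spread out over `ℕ`.
  set s := Function.support fun i => ‖x i‖ ^ 2
  have : Countable s := hx.countable_support
  obtain ⟨e, he⟩ := exists_injective_nat s
  let z : ℕ → H × H := Function.extend e (fun i : s => (x i, y i)) 0
  have apply_z {E : Type} [Zero E] (F : H × H → E) (h0 : F 0 = 0) (n : ℕ) :
      F (z n) = Function.extend e (fun i : s => F (x i, y i)) 0 n := by
    refine (Function.apply_extend F ..).trans ?_
    congr 1
    exact funext fun _ => h0
  have summable_z (F : H × H → ℝ) (h0 : F 0 = 0) (hF : Summable fun i => F (x i, y i)) :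
      Summable fun n => F (z n) := by
    simp only [apply_z F h0, summable_extend_zero he]
    exact hF.comp_injective Subtype.val_injective
  have tsum_z (A : H →L[ℂ] H) : ∑' n, ⟪(z n).1, A (z n).2⟫ = vectorFunctional hx hy A := by
    simp only [apply_z (fun p => ⟪p.1, A p.2⟫) (by simp), tsum_extend_zero he,
      vectorFunctional_apply]
    refine tsum_subtype_eq_of_support_subset (f := fun i => ⟪x i, A (y i)⟫) fun i hi h0 => hi ?_
    have : x i = 0 := by simpa using h0
    simp [this]
  simpa only [tsum_z] using! isNormalFunctional_tsum_inner
    (summable_z (fun p => ‖p.1‖ ^ 2) (by simp) hx) (summable_z (fun p => ‖p.2‖ ^ 2) (by simp) hy)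

theorem isNormalFunctional_inner (x y : H) : IsNormalFunctional fun A : H →L[ℂ] H => ⟪x, A y⟫ := by
  convert isNormalFunctional_vectorFunctional (ι := Unit) (x := fun _ => x) (y := fun _ => y)
    Summable.of_finite Summable.of_finite with A
  simp only [vectorFunctional_apply, tsum_fintype, Finset.univ_unique, Finset.sum_singleton]

theorem SigmaWeakTendsto.inner {ι : Type*} {f : ι → (H →L[ℂ] H)} {l : Filter ι}
    {B : H →L[ℂ] H} (hf : SigmaWeakTendsto f l B) (x y : H) :
    Tendsto (fun i => ⟪x, f i y⟫) l (𝓝 ⟪x, B y⟫) :=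
  (isNormalFunctional_inner x y).tendsto hf

/-- Norm balls of `B(H)` are `σ`-weakly compact, in terms of ultrafilters. -/
theorem exists_sigmaWeakTendsto_of_ultrafilter [CompleteSpace H] {ι : Type*} {f : ι → (H →L[ℂ] H)}
    (l : Ultrafilter ι) {M : ℝ} (hM : ∀ᶠ i in l, ‖f i‖ ≤ M) :
    ∃ B : H →L[ℂ] H, SigmaWeakTendsto f l B := by
  have hb (x y : H) : ∀ᶠ i in l, ‖⟪x, f i y⟫‖ ≤ M * ‖x‖ * ‖y‖ := by
    filter_upwards [hM] with i hi
    calc ‖⟪x, f i y⟫‖ ≤ ‖x‖ * (M * ‖y‖) :=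
          (norm_inner_le_norm _ _).trans (by gcongr; exact (f i).le_of_opNorm_le hi y)
      _ = M * ‖x‖ * ‖y‖ := by ring
  have hlim (x y : H) : ∃ z, Tendsto (fun i => ⟪x, f i y⟫) l (𝓝 z) := by
    obtain ⟨z, -, hz⟩ := (isCompact_closedBall (0 : ℂ) (M * ‖x‖ * ‖y‖)).ultrafilter_le_nhds
      (l.map fun i => ⟪x, f i y⟫) <| le_principal_iff.2 <|
        (hb x y).mono fun i hi => mem_closedBall_zero_iff.2 hi
    exact ⟨z, hz⟩
  choose β hβ using hlim
  let φ : H →ₗ⋆[ℂ] H →ₗ[ℂ] ℂ := LinearMap.mk₂'ₛₗ _ _ β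
    (fun x x' y => tendsto_nhds_unique (hβ _ _) <| by
      simpa only [inner_add_left] using (hβ x y).add (hβ x' y))
    (fun c x y => tendsto_nhds_unique (hβ _ _) <| by
      simpa only [inner_smul_left, smul_eq_mul] using (hβ x y).const_mul (starRingEnd ℂ c))
    (fun x y y' => tendsto_nhds_unique (hβ _ _) <| by
      simpa only [map_add, inner_add_right] using (hβ x y).add (hβ x y'))
    (fun c x y => tendsto_nhds_unique (hβ _ _) <| by
      simpa only [map_smul, inner_smul_right, smul_eq_mul, RingHom.id_apply] using
        (hβ x y).const_mul c)
  have hφ (x y : H) : ‖φ x y‖ ≤ M * ‖x‖ * ‖y‖ := le_of_tendsto (hβ x y).norm (hb x y)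
  refine ⟨operatorOfForm φ hφ, sigmaWeakTendsto_of_bounded hM fun x y => ?_⟩
  rw [inner_operatorOfForm]
  exact hβ x y

end SigmaWeakFunctionals

section SigmaWeakMultiplication

variable {H : Type u} [NormedAddCommGroup H] [InnerProductSpace ℂ H]

theorem summable_norm_sq_apply {ι : Type*} {x : ι → H} (hx : Summable fun n => ‖x n‖ ^ 2)
    (G : H →L[ℂ] H) : Summable fun n => ‖G (x n)‖ ^ 2 := by
  refine .of_nonneg_of_le (fun _ => by positivity) (fun n => ?_) (hx.mul_left (‖G‖ ^ 2))
  rw [← mul_pow]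
  gcongr
  exact G.le_opNorm _

variable {ι : Type*} {f : ι → (H →L[ℂ] H)} {l : Filter ι} {B : H →L[ℂ] H}

theorem SigmaWeakTendsto.comp_const (hf : SigmaWeakTendsto f l B) (G : H →L[ℂ] H) :
    SigmaWeakTendsto (fun i => f i ∘L G) l (B ∘L G) := by
  rw [sigmaWeakTendsto_iff] at hf ⊢
  intro x y hx hy
  exact hf x _ hx (summable_norm_sq_apply hy G)

variable [CompleteSpace H]

theorem SigmaWeakTendsto.const_comp (hf : SigmaWeakTendsto f l B) (G : H →L[ℂ] H) :
    SigmaWeakTendsto (fun i => G ∘L f i) l (G ∘L B) := by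
  rw [sigmaWeakTendsto_iff] at hf ⊢
  intro x y hx hy
  simpa only [comp_apply, adjoint_inner_left] using
    hf _ y (summable_norm_sq_apply hx (adjoint G)) hy

theorem SigmaWeakTendsto.star (hf : SigmaWeakTendsto f l B) :
    SigmaWeakTendsto (fun i => star (f i)) l (star B) := by
  rw [sigmaWeakTendsto_iff] at hf ⊢
  intro x y hx hy
  simpa only [Function.comp_def, Complex.conj_tsum, inner_conj_symm, star_eq_adjoint,
    adjoint_inner_right] using (Complex.continuous_conj.tendsto _).comp (hf y x hy hx)

theorem SigmaWeakTendsto.comp_add_comp_adjoint (hf : SigmaWeakTendsto f l B) (G : H →L[ℂ] H) :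
    SigmaWeakTendsto (fun i => G ∘L f i + f i ∘L adjoint G) l (G ∘L B + B ∘L adjoint G) :=
  (hf.const_comp G).add (hf.comp_const (adjoint G))

theorem isSigmaWeaklyContinuous_comp_add_comp_adjoint (𝒟 : Set (H →L[ℂ] H)) (G : H →L[ℂ] H) :
    IsSigmaWeaklyContinuous (𝒟 := 𝒟)
      fun A => G ∘L (A : H →L[ℂ] H) + (A : H →L[ℂ] H) ∘L adjoint G := by
  let _ := sigmaWeakTopology H
  exact continuous_iff_continuousAt.2 fun A =>
    SigmaWeakTendsto.comp_add_comp_adjoint (continuous_subtype_val.tendsto A) G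

theorem IsSigmaWeaklyClosable.of_add_comp_add_comp_adjoint {𝒟 : Set (H →L[ℂ] H)}
    {φ : 𝒟 → (H →L[ℂ] H)} {G : H →L[ℂ] H}
    (hφ : IsSigmaWeaklyClosable fun A =>
      φ A + (G ∘L (A : H →L[ℂ] H) + (A : H →L[ℂ] H) ∘L adjoint G)) :
    IsSigmaWeaklyClosable φ := by
  intro l _ B hl hB
  refine hφ l B hl ?_
  simpa only [comp_zero, zero_comp, add_zero] using hB.add (hl.comp_add_comp_adjoint G)

end SigmaWeakMultiplication

section PositiveFunctionals

open scoped ComplexOrder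

section CStarAlgebra

variable {A : Type*} [CStarAlgebra A] [PartialOrder A] [StarOrderedRing A] (f : A →ₚ[ℂ] ℂ)

theorem norm_apply_mul_le (a b : A) :
    ‖f (a * b)‖ ≤ √(f (a * star a)).re * √(f (star b * b)).re := by
  simpa only [PositiveLinearMap.preGNS_norm_def, PositiveLinearMap.preGNS_inner_def,
    PositiveLinearMap.ofPreGNS_toPreGNS, star_star] using
    norm_inner_le_norm (𝕜 := ℂ) (f.toPreGNS (star a)) (f.toPreGNS b)

theorem tendsto_apply_mul_of_isStarProjection {ι : Type*} {l : Filter ι} {p : ι → A}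
    (hp : ∀ i, IsStarProjection (p i)) (hf : Tendsto (fun i => f (1 - p i)) l (𝓝 0)) (a : A) :
    Tendsto (fun i => f (a * p i)) l (𝓝 (f a)) := by
  have hsqrt : Tendsto (fun i => √(f (1 - p i)).re) l (𝓝 0) := by
    simpa only [Function.comp_def, Complex.zero_re, Real.sqrt_zero] using
      (Real.continuous_sqrt.comp Complex.continuous_re).tendsto 0 |>.comp hf
  have hle (i : ι) : ‖f (a * p i) - f a‖ ≤ √(f (a * star a)).re * √(f (1 - p i)).re := by
    have hq := (hp i).one_sub
    have h := norm_apply_mul_le f a (1 - p i)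
    rwa [hq.isSelfAdjoint.star_eq, hq.isIdempotentElem.eq, mul_sub, mul_one, map_sub,
      norm_sub_rev] at h
  rw [tendsto_iff_norm_sub_tendsto_zero]
  refine squeeze_zero (fun _ => norm_nonneg _) hle ?_
  simpa only [mul_zero] using hsqrt.const_mul √(f (a * star a)).re

end CStarAlgebra

variable {H : Type u} [NormedAddCommGroup H] [InnerProductSpace ℂ H]

section FiniteProjection

variable {ι : Type*} (b : HilbertBasis ι ℂ H)

/-- The projection `∑ i ∈ F, |bᵢ⟩⟨bᵢ|` onto the span of finitely many vectors of a Hilbert basis. -/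
noncomputable def finiteProjection (F : Finset ι) : H →L[ℂ] H :=
  ∑ i ∈ F, InnerProductSpace.rankOne ℂ (b i) (b i)

theorem tendsto_finiteProjection_apply (v : H) :
    Tendsto (fun F => finiteProjection b F v) atTop (𝓝 v) := by
  simpa only [HasSum, SummationFilter.unconditional_filter, finiteProjection, sum_apply,
    InnerProductSpace.rankOne_apply, HilbertBasis.repr_apply_apply] using b.hasSum_repr v

variable [CompleteSpace H]

theorem isStarProjection_finiteProjection (F : Finset ι) :
    IsStarProjection (finiteProjection b F) := by
  classical
  refine ⟨?_, ?_⟩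
  · simp [IsIdempotentElem, finiteProjection, Finset.sum_mul_sum, mul_def,
      InnerProductSpace.rankOne_comp_rankOne, orthonormal_iff_ite.1 b.orthonormal]
  · simp [IsSelfAdjoint, finiteProjection, star_sum, star_eq_adjoint]

theorem finiteProjection_mono : Monotone (finiteProjection b) := fun F G hFG =>
  Finset.sum_le_sum_of_subset_of_nonneg hFG fun i _ _ => by
    rw [nonneg_iff_isPositive]
    exact InnerProductSpace.isPositive_rankOne_self _

theorem norm_mul_finiteProjection_le (A : H →L[ℂ] H) (F : Finset ι) :
    ‖A * finiteProjection b F‖ ≤ ‖A‖ :=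
  (norm_mul_le _ _).trans <|
    mul_le_of_le_one_right (norm_nonneg _) (isStarProjection_finiteProjection b F).norm_le

theorem sigmaWeakTendsto_one_sub_finiteProjection :
    SigmaWeakTendsto (fun F => 1 - finiteProjection b F) atTop 0 := by
  refine sigmaWeakTendsto_of_bounded (M := 1)
    (.of_forall fun F => (isStarProjection_finiteProjection b F).one_sub.norm_le) fun x y => ?_
  simpa [inner_sub_right] using tendsto_const_nhds.inner (𝕜 := ℂ) (x := x)
    (tendsto_const_nhds (x := y) |>.sub (tendsto_finiteProjection_apply b y))

end FiniteProjection

variable [CompleteSpace H]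

/-- The operator `ρ` with `f (|w⟩⟨v|) = ⟨ρ v, w⟩`; for a normal positive functional `f` it is the
density operator, `f A = tr (ρ A)`. -/
noncomputable def densityOperator (f : (H →L[ℂ] H) →L[ℂ] ℂ) : H →L[ℂ] H :=
  InnerProductSpace.continuousLinearMapOfBilin <|
    (compL ℂ H (H →L[ℂ] H) ℂ f).comp (InnerProductSpace.rankOne ℂ (E := H) (F := H)).flip

theorem inner_densityOperator (f : (H →L[ℂ] H) →L[ℂ] ℂ) (v w : H) :
    ⟪densityOperator f v, w⟫ = f (InnerProductSpace.rankOne ℂ w v) :=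
  InnerProductSpace.continuousLinearMapOfBilin_apply _ v w

theorem densityOperator_nonneg {f : (H →L[ℂ] H) →L[ℂ] ℂ} (hf : ∀ A, 0 ≤ A → 0 ≤ f A) :
    0 ≤ densityOperator f := by
  rw [nonneg_iff_isPositive, isPositive_iff_complex]
  intro v
  have h : 0 ≤ ⟪densityOperator f v, v⟫ := by
    rw [inner_densityOperator]
    exact hf _ ((nonneg_iff_isPositive _).2 (InnerProductSpace.isPositive_rankOne_self v))
  obtain ⟨hre, him⟩ := Complex.nonneg_iff.1 h
  exact ⟨Complex.ext (Complex.ofReal_re _) him, hre⟩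

theorem exists_inner_eq_apply_rankOne (f : (H →L[ℂ] H) →ₚ[ℂ] ℂ) :
    ∃ s : H →L[ℂ] H, IsSelfAdjoint s ∧ ∀ v w, ⟪s v, s w⟫ = f (InnerProductSpace.rankOne ℂ w v) := by
  obtain ⟨C, hC⟩ := f.exists_norm_apply_le
  let f' : (H →L[ℂ] H) →L[ℂ] ℂ := f.toLinearMap.mkContinuous C hC
  have hρ : 0 ≤ densityOperator f' := densityOperator_nonneg fun A hA => map_nonneg f hA
  have hs : IsSelfAdjoint (CFC.sqrt (densityOperator f')) := .of_nonneg (CFC.sqrt_nonneg _)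
  refine ⟨_, hs, fun v w => ?_⟩
  rw [← adjoint_inner_left, hs.adjoint_eq, ← mul_apply_eq_comp, CFC.sqrt_mul_sqrt_self _ hρ,
    inner_densityOperator]
  rfl

theorem summable_norm_sq_of_inner_eq {ι : Type*} (b : HilbertBasis ι ℂ H)
    {f : (H →L[ℂ] H) →ₚ[ℂ] ℂ} {s : H →L[ℂ] H}
    (hs : ∀ v w, ⟪s v, s w⟫ = f (InnerProductSpace.rankOne ℂ w v)) :
    Summable fun i => ‖s (b i)‖ ^ 2 := by
  refine summable_of_sum_le (c := (f 1).re) (fun _ => by positivity) fun F => ?_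
  have hsum : ((∑ i ∈ F, ‖s (b i)‖ ^ 2 : ℝ) : ℂ) = f (finiteProjection b F) := by
    simp only [finiteProjection, map_sum, ← hs, inner_self_eq_norm_sq_to_K]
    push_cast
    rfl
  have hle : f (finiteProjection b F) ≤ f 1 :=
    OrderHomClass.mono f (isStarProjection_finiteProjection b F).le_one
  rw [← hsum] at hle
  exact (Complex.le_def.1 hle).1

theorem isNormalFunctional_of_tendsto_finiteProjection {ι : Type*} (b : HilbertBasis ι ℂ H)
    (f : (H →L[ℂ] H) →ₚ[ℂ] ℂ)
    (hf : Tendsto (fun F => f (1 - finiteProjection b F)) atTop (𝓝 0)) : IsNormalFunctional f := by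
  obtain ⟨s, hs, hsf⟩ := exists_inner_eq_apply_rankOne f
  have hsum := summable_norm_sq_of_inner_eq b hsf
  have eq_rankOne (v w : H) : vectorFunctional hsum hsum (InnerProductSpace.rankOne ℂ w v)
      = f (InnerProductSpace.rankOne ℂ w v) := by
    rw [← hsf, ← b.tsum_inner_mul_inner (s v) (s w), vectorFunctional_apply]
    refine tsum_congr fun i => ?_
    rw [InnerProductSpace.rankOne_apply, inner_smul_right,
      ← adjoint_inner_left, hs.adjoint_eq, ← adjoint_inner_right s (b i), hs.adjoint_eq]
  have eq_finite (A : H →L[ℂ] H) (F : Finset ι) :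
      vectorFunctional hsum hsum (A * finiteProjection b F) = f (A * finiteProjection b F) := by
    simp only [finiteProjection, Finset.mul_sum, mul_def, InnerProductSpace.comp_rankOne, map_sum,
      eq_rankOne]
  have eq_all (A : H →L[ℂ] H) : f A = vectorFunctional hsum hsum A := by
    refine tendsto_nhds_unique (tendsto_apply_mul_of_isStarProjection f
      (isStarProjection_finiteProjection b) hf A) ?_
    simp only [← eq_finite]
    exact tendsto_vectorFunctional_of_bounded hsum hsum
      (.of_forall (norm_mul_finiteProjection_le b A)) fun x y =>
        tendsto_const_nhds.inner <|
          (A.continuous.tendsto _).comp (tendsto_finiteProjection_apply b y)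
  rw [funext eq_all]
  exact isNormalFunctional_vectorFunctional hsum hsum

end PositiveFunctionals

section Stinespring

universe v

variable {𝒜 : Type v} [NormedRing 𝒜] [StarRing 𝒜] [NormedAlgebra ℂ 𝒜]
  {H : Type u} [NormedAddCommGroup H] [InnerProductSpace ℂ H]

theorem norm_sq_sum_eq_re_sum_inner {α K : Type*} [NormedAddCommGroup K] [InnerProductSpace ℂ K]
    (s : Finset α) (f : α → K) :
    ‖∑ a ∈ s, f a‖ ^ 2 = (∑ a ∈ s, ∑ b ∈ s, ⟪f a, f b⟫).re := by
  rw [← inner_self_eq_norm_sq (𝕜 := ℂ), sum_inner]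
  simp only [inner_sum]
  rfl

theorem sum_sum_equivFin {α M : Type*} [AddCommMonoid M] (s : Finset α) (f : α → α → M) :
    ∑ i, ∑ j, f (s.equivFin.symm i) (s.equivFin.symm j) = ∑ a ∈ s, ∑ b ∈ s, f a b := by
  rw [s.equivFin.symm.sum_comp (fun a : s => ∑ j, f a (s.equivFin.symm j)),
    ← Finset.sum_coe_sort s]
  refine Finset.sum_congr rfl fun a _ => ?_
  rw [s.equivFin.symm.sum_comp (fun b : s => f a b), Finset.sum_coe_sort]

/-- The real part of `∑ᵢⱼ ⟨φ(aⱼ* aᵢ) xᵢ, xⱼ⟩`, which is `‖∑ᵢ π(aᵢ) V xᵢ‖²` if `φ = V* π(·) V`. -/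
noncomputable def gramForm (φ : 𝒜 →ₗ[ℂ] H →L[ℂ] H) {ι : Type*} [Fintype ι] (a : ι → 𝒜)
    (x : ι → H) : ℝ :=
  (∑ i, ∑ j, ⟪φ (star (a j) * a i) (x i), x j⟫).re

theorem continuous_gramForm (φ : 𝒜 →ₗ[ℂ] H →L[ℂ] H) {ι : Type*} [Fintype ι] (a : ι → 𝒜) :
    Continuous (gramForm φ a) := by
  unfold gramForm
  fun_prop

theorem gramForm_sub (φ ψ : 𝒜 →ₗ[ℂ] H →L[ℂ] H) {ι : Type*} [Fintype ι] (a : ι → 𝒜) (x : ι → H) :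
    gramForm (φ - ψ) a x = gramForm φ a x - gramForm ψ a x := by
  simp only [gramForm, LinearMap.sub_apply, sub_apply, inner_sub_left, Finset.sum_sub_distrib,
    Complex.sub_re]

theorem gramForm_mul_add_gramForm_mul (φ : 𝒜 →ₗ[ℂ] H →L[ℂ] H) {ι : Type*} [Fintype ι] {c d : 𝒜}
    {r : ℝ} (h : star c * c + star d * d = (r : ℂ) • (1 : 𝒜)) (a : ι → 𝒜) (x : ι → H) :
    gramForm φ (fun i => c * a i) x + gramForm φ (fun i => d * a i) x = r * gramForm φ a x := by
  have key (i j : ι) : ⟪φ (star (c * a j) * (c * a i)) (x i), x j⟫ +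
      ⟪φ (star (d * a j) * (d * a i)) (x i), x j⟫ =
        (r : ℂ) * ⟪φ (star (a j) * a i) (x i), x j⟫ := by
    have : star (c * a j) * (c * a i) + star (d * a j) * (d * a i) =
        (r : ℂ) • (star (a j) * a i) := calc
      _ = star (a j) * (star c * c + star d * d) * a i := by
        simp only [star_mul, mul_add, add_mul, mul_assoc]
      _ = _ := by rw [h]; simp
    rw [← inner_add_left, ← add_apply, ← map_add, this, map_smul, smul_apply, inner_smul_left,
      Complex.conj_ofReal]
  simp only [gramForm, ← Complex.add_re, ← Finset.sum_add_distrib, key, ← Finset.mul_sum,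
    Complex.re_ofReal_mul]

variable {K : Type*} [NormedAddCommGroup K] [InnerProductSpace ℂ K]

/-- A Kolmogorov decomposition of the kernel `(b, a) ↦ φ(b* a)`: in terms of a Stinespring
dilation `φ = V* π(·) V` it is `Λ a = π(a) V`. -/
structure IsKolmogorovDecomposition (φ : 𝒜 →ₗ[ℂ] H →L[ℂ] H) (Λ : 𝒜 →ₗ[ℂ] H →L[ℂ] K) : Prop where
  inner_apply : ∀ a b x y, ⟪Λ a x, Λ b y⟫ = ⟪φ (star b * a) x, y⟫
  dense_span : Dense (Submodule.span ℂ {Λ a x | (a : 𝒜) (x : H)} : Set K)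

variable {φ : 𝒜 →ₗ[ℂ] H →L[ℂ] H} {Λ : 𝒜 →ₗ[ℂ] H →L[ℂ] K}

theorem IsKolmogorovDecomposition.hom_ext {F : Type*} [NormedAddCommGroup F] [NormedSpace ℂ F]
    (hΛ : IsKolmogorovDecomposition φ Λ) {S T : K →L[ℂ] F} (h : ∀ a x, S (Λ a x) = T (Λ a x)) :
    S = T :=
  ext_on hΛ.dense_span <| by
    rintro _ ⟨a, x, rfl⟩
    exact h a x

theorem IsKolmogorovDecomposition.ext_inner (hΛ : IsKolmogorovDecomposition φ Λ) {u v : K}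
    (h : ∀ a x, ⟪u, Λ a x⟫ = ⟪v, Λ a x⟫) : u = v :=
  ext_inner_right ℂ <| DFunLike.congr_fun (hΛ.hom_ext (S := innerSL ℂ u) (T := innerSL ℂ v) h)

variable [CompleteSpace H]

theorem gramForm_cons (hφ : ∀ a, φ (star a) = star (φ a)) {n : ℕ} (b : 𝒜) (y : H)
    (a : Fin n → 𝒜) (x : Fin n → H) :
    gramForm φ (Fin.cons b a : Fin (n + 1) → 𝒜) (Fin.cons y x : Fin (n + 1) → H) =
      gramForm φ a x + 2 * (∑ j, ⟪φ (star (a j) * b) y, x j⟫).re + (⟪φ (star b * b) y, y⟫).re := by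
  have re_swap (j : Fin n) :
      (⟪φ (star b * a j) (x j), y⟫).re = (⟪φ (star (a j) * b) y, x j⟫).re := by
    rw [← star_star b, ← star_mul, hφ, star_star, star_eq_adjoint, adjoint_inner_left,
      ← inner_conj_symm, Complex.conj_re]
  simp only [gramForm, Fin.sum_univ_succ, Fin.cons_zero, Fin.cons_succ, Complex.add_re,
    Complex.re_sum, Finset.sum_add_distrib, re_swap]
  ring

/-- The maps `φ : 𝒜 → B(H)` of the form `V* π(·) V` with a contractive `*`-representation `π`:
these are the completely positive maps for which, in the semi-inner product of the Stinespring
construction, left multiplication by `c` is bounded by `‖c‖`. The latter is automatic if `𝒜` is a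
C⋆-algebra, but not if `𝒜` is not complete. -/
structure IsDilatable (φ : 𝒜 →ₗ[ℂ] H →L[ℂ] H) : Prop where
  map_star : ∀ a, φ (star a) = star (φ a)
  gramForm_nonneg : ∀ {n : ℕ} (a : Fin n → 𝒜) (x : Fin n → H), 0 ≤ gramForm φ a x
  gramForm_mul_le : ∀ (c : 𝒜) {n : ℕ} (a : Fin n → 𝒜) (x : Fin n → H),
    gramForm φ (fun i => c * a i) x ≤ ‖c‖ ^ 2 * gramForm φ a x

theorem IsDilatable.exists_isKolmogorovDecomposition [StarModule ℂ 𝒜] (hφ : IsDilatable φ) :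
    ∃ (K : Type (max u v)) (_ : NormedAddCommGroup K) (_ : InnerProductSpace ℂ K)
      (_ : CompleteSpace K) (Λ : 𝒜 →ₗ[ℂ] H →L[ℂ] K), IsKolmogorovDecomposition φ Λ := by
  let M : Matrix 𝒜 𝒜 (H →L[ℂ] H) := Matrix.of fun b a => φ (star b * a)
  have hM : M.PosSemidef := by
    have htfae := (RKHS.posSemidef_tfae (K := M)).out 0 2
    refine htfae.2 ⟨?_, fun v => ?_⟩
    · ext1 b a
      simp [M, Matrix.conjTranspose_apply, ← hφ.map_star]
    · have := hφ.gramForm_nonneg (fun i => (v.support.equivFin.symm i : 𝒜))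
        (fun i => v (v.support.equivFin.symm i))
      rwa [gramForm, sum_sum_equivFin v.support fun a b => ⟪φ (star b * a) (v a), v b⟫] at this
  have : Fact M.PosSemidef := ⟨hM⟩
  let K := RKHS.OfKernel M
  have inner_kerFun (a b : 𝒜) (x y : H) :
      ⟪RKHS.kerFun K a x, RKHS.kerFun K b y⟫ = ⟪φ (star b * a) x, y⟫ := by
    rw [← RKHS.kernel_inner, RKHS.OfKernel.kernel_ofKernel]
    rfl
  let Λ : 𝒜 →ₗ[ℂ] H →L[ℂ] K :=
    { toFun a := RKHS.kerFun K a
      map_add' a b := by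
        ext1 x
        rw [← sub_eq_zero, ← inner_self_eq_zero (𝕜 := ℂ)]
        simp only [inner_sub_left, inner_sub_right, inner_add_left, inner_add_right, inner_kerFun,
          star_add, add_mul, mul_add, map_add, add_apply]
        ring
      map_smul' r a := by
        ext1 x
        rw [← sub_eq_zero, ← inner_self_eq_zero (𝕜 := ℂ)]
        simp only [inner_sub_left, inner_sub_right, inner_smul_left, inner_smul_right,
          inner_kerFun, star_smul, smul_mul_assoc, mul_smul_comm, map_smul, smul_apply,
          RCLike.star_def, Complex.conj_conj, RingHom.id_apply]
        ring }
  refine ⟨K, inferInstance, inferInstance, inferInstance, Λ, inner_kerFun, ?_⟩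
  exact Submodule.dense_iff_topologicalClosure_eq_top.2 (RKHS.kerFun_dense K)

namespace IsKolmogorovDecomposition

theorem exists_apply_eq_mul [CompleteSpace K] (hΛ : IsKolmogorovDecomposition φ Λ)
    (hφ : IsDilatable φ) (c : 𝒜) :
    ∃ P : K →L[ℂ] K, ‖P‖ ≤ ‖c‖ ∧ ∀ a x, P (Λ a x) = Λ (c * a) x := by
  let L (c : 𝒜) : (𝒜 →₀ H) →ₗ[ℂ] K := Finsupp.lsum ℂ fun a => (Λ (c * a)).toLinearMap
  have L_single (c a : 𝒜) (x : H) : L c (.single a x) = Λ (c * a) x := by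
    simp [L]
  have norm_sq_L (c : 𝒜) (v : 𝒜 →₀ H) : ‖L c v‖ ^ 2 =
      gramForm φ (fun i => c * (v.support.equivFin.symm i : 𝒜))
        (fun i => v (v.support.equivFin.symm i)) := by
    rw [gramForm, sum_sum_equivFin v.support fun a b => ⟪φ (star (c * b) * (c * a)) (v a), v b⟫]
    simp only [← hΛ.inner_apply]
    exact norm_sq_sum_eq_re_sum_inner _ _
  have norm_L_le (v : 𝒜 →₀ H) : ‖L c v‖ ≤ ‖c‖ * ‖L 1 v‖ := by
    rw [← sq_le_sq₀ (by positivity) (by positivity), mul_pow, norm_sq_L, norm_sq_L]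
    simpa only [one_mul] using hφ.gramForm_mul_le c _ _
  have dense_L : DenseRange (L 1) := by
    refine hΛ.dense_span.mono (Submodule.span_le (p := (L 1).range).2 ?_)
    rintro _ ⟨a, x, rfl⟩
    exact ⟨.single a x, by rw [L_single, one_mul]⟩
  refine ⟨(L c).extendOfNorm (L 1),
    LinearMap.opNorm_extendOfNorm_le dense_L (norm_nonneg c) norm_L_le, fun a x => ?_⟩
  have h := LinearMap.extendOfNorm_eq dense_L ⟨_, norm_L_le⟩ (.single a x)
  rwa [L_single, L_single, one_mul] at h

theorem exists_starAlgHom [CompleteSpace K] (hΛ : IsKolmogorovDecomposition φ Λ)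
    (hφ : IsDilatable φ) :
    ∃ π : 𝒜 →⋆ₐ[ℂ] (K →L[ℂ] K), (∀ a, ‖π a‖ ≤ ‖a‖) ∧ ∀ c a x, π c (Λ a x) = Λ (c * a) x := by
  choose P hP_norm hP using hΛ.exists_apply_eq_mul hφ
  refine ⟨
    { toFun := P
      map_one' := hΛ.hom_ext fun a x => by rw [hP, one_mul, one_apply_eq_self]
      map_mul' := fun c d => hΛ.hom_ext fun a x => by
        rw [mul_apply_eq_comp, hP, hP, hP, mul_assoc]
      map_zero' := hΛ.hom_ext fun a x => by rw [hP, zero_mul, map_zero, zero_apply, zero_apply]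
      map_add' := fun c d => hΛ.hom_ext fun a x => by
        rw [hP, add_apply, hP, hP, add_mul, map_add, add_apply]
      commutes' := fun r => hΛ.hom_ext fun a x => by
        rw [hP, ← Algebra.smul_def, map_smul, Algebra.algebraMap_eq_smul_one, smul_apply,
          smul_apply, one_apply_eq_self]
      map_star' := fun c => ?_ }, hP_norm, hP⟩
  refine hΛ.hom_ext fun a x => hΛ.ext_inner fun b y => ?_
  rw [star_eq_adjoint, adjoint_inner_left, hP, hP, hΛ.inner_apply, hΛ.inner_apply, star_mul,
    mul_assoc]

end IsKolmogorovDecomposition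

theorem IsDilatable.exists_dilation [StarModule ℂ 𝒜] (hφ : IsDilatable φ) :
    ∃ (K : Type (max u v)) (_ : NormedAddCommGroup K) (_ : InnerProductSpace ℂ K)
      (_ : CompleteSpace K) (V : H →L[ℂ] K) (π : 𝒜 →⋆ₐ[ℂ] (K →L[ℂ] K)),
      (∀ a, ‖π a‖ ≤ ‖a‖) ∧ ∀ a, φ a = adjoint V ∘L π a ∘L V := by
  obtain ⟨K, _, _, _, Λ, hΛ⟩ := hφ.exists_isKolmogorovDecomposition
  obtain ⟨π, hπ_norm, hπ⟩ := hΛ.exists_starAlgHom hφ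
  refine ⟨K, inferInstance, inferInstance, inferInstance, Λ 1, π, hπ_norm, fun a => ?_⟩
  ext x
  refine ext_inner_right ℂ fun y => ?_
  rw [comp_apply, comp_apply, adjoint_inner_left, hπ, hΛ.inner_apply, star_one, one_mul, mul_one]

end Stinespring

section CompletelyPositive

universe v

variable {H : Type u} [NormedAddCommGroup H] [InnerProductSpace ℂ H] [CompleteSpace H]

theorem re_sum_inner_nonneg_of_cstarMatrix_nonneg {ι : Type*} [Fintype ι]
    {M : CStarMatrix ι ι (H →L[ℂ] H)} (hM : 0 ≤ M) (x : ι → H) :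
    0 ≤ (∑ i, ∑ j, ⟪M j i (x i), x j⟫).re := by
  rw [StarOrderedRing.nonneg_iff] at hM
  induction hM using AddSubmonoid.closure_induction with
  | mem M hM =>
    obtain ⟨P, rfl⟩ := hM
    have sum_eq : ∑ i, ∑ j, ⟪(star P * P) j i (x i), x j⟫ =
        ∑ k, ∑ i, ∑ j, ⟪P k i (x i), P k j (x j)⟫ := by
      simp only [CStarMatrix.mul_apply, CStarMatrix.star_apply, star_eq_adjoint, sum_apply,
        sum_inner, mul_apply_eq_comp, adjoint_inner_left]
      rw [Finset.sum_comm (s := Finset.univ) (t := Finset.univ)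
        (f := fun k i => ∑ j, ⟪P k i (x i), P k j (x j)⟫)]
      exact Finset.sum_congr rfl fun i _ => Finset.sum_comm
    rw [sum_eq, Complex.re_sum]
    simp only [← norm_sq_sum_eq_re_sum_inner]
    positivity
  | zero => simp
  | add M N _ _ hM hN =>
    have add_apply (i j : ι) :
        ⟪(M + N) j i (x i), x j⟫ = ⟪M j i (x i), x j⟫ + ⟪N j i (x i), x j⟫ :=
      inner_add_left _ _ _
    simp only [add_apply, Finset.sum_add_distrib, Complex.add_re]
    exact add_nonneg hM hN

variable {A : Type v} [CStarAlgebra A] [PartialOrder A] [StarOrderedRing A]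
  (T : A →CP (H →L[ℂ] H))

theorem gramForm_completelyPositiveMap_nonneg {ι : Type*} [Fintype ι] (a : ι → A) (x : ι → H) :
    0 ≤ gramForm T.toLinearMap a x := by
  classical
  rcases isEmpty_or_nonempty ι with _ | ⟨⟨i₀⟩⟩
  · simp [gramForm]
  let N : CStarMatrix ι ι A :=
    CStarMatrix.ofMatrix (Matrix.of fun k i => if k = i₀ then a i else 0)
  have star_N_mul_N (i j : ι) : (star N * N) j i = star (a j) * a i := by
    rw [CStarMatrix.mul_apply, Finset.sum_eq_single i₀] <;>
      simp +contextual [N, CStarMatrix.star_apply]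
  have hT (i j : ι) : (star N * N).map T j i = T (star (a j) * a i) := by
    rw [CStarMatrix.map_apply, star_N_mul_N]
  change 0 ≤ (∑ i, ∑ j, ⟪T (star (a j) * a i) (x i), x j⟫).re
  simp only [← hT]
  exact re_sum_inner_nonneg_of_cstarMatrix_nonneg
    (T.map_cstarMatrix_nonneg _ (star_mul_self_nonneg N)) x

theorem isDilatable_completelyPositiveMap : IsDilatable T.toLinearMap where
  map_star := map_star (PositiveLinearMap.mk T.toLinearMap (OrderHomClass.mono T))
  gramForm_nonneg := gramForm_completelyPositiveMap_nonneg T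
  gramForm_mul_le c n a x := by
    have h : 0 ≤ ((‖c‖ ^ 2 : ℝ) : ℂ) • (1 : A) - star c * c := by
      rw [Complex.coe_smul, sub_nonneg, ← Algebra.algebraMap_eq_smul_one, sq,
        ← CStarRing.norm_star_mul_self]
      exact IsSelfAdjoint.le_algebraMap_norm_self (IsSelfAdjoint.star_mul_self c)
    obtain ⟨d, hd⟩ := CStarAlgebra.nonneg_iff_eq_star_mul_self.1 h
    rw [sub_eq_iff_eq_add'] at hd
    rw [← gramForm_mul_add_gramForm_mul T.toLinearMap hd.symm]
    exact le_add_of_nonneg_right (gramForm_completelyPositiveMap_nonneg T _ _)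

/-- The defect of multiplicativity of a map `T` at `a`, in the sense of Kadison's inequality
`T(a)* T(a) ≤ T(a* a)`. For a unital completely positive `T` it is a seminorm in `a`. -/
noncomputable def multiplicativityDefect (T : A →CP (H →L[ℂ] H)) (a : A) : ℝ :=
  √‖T (star a * a) - star (T a) * T a‖

variable {T}

theorem exists_isometry_dilation (hT : T 1 = 1) :
    ∃ (K : Type (max u v)) (_ : NormedAddCommGroup K) (_ : InnerProductSpace ℂ K)
      (_ : CompleteSpace K) (V : H →L[ℂ] K) (π : A →⋆ₐ[ℂ] (K →L[ℂ] K)), adjoint V ∘L V = 1 ∧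
      ‖V‖ ≤ 1 ∧ (∀ a, ‖π a‖ ≤ ‖a‖) ∧ ∀ a, T a = adjoint V ∘L π a ∘L V := by
  obtain ⟨K, _, _, _, V, π, hπ, hV⟩ := (isDilatable_completelyPositiveMap T).exists_dilation
  have adjoint_comp_self : adjoint V ∘L V = 1 := by
    have : T 1 = adjoint V ∘L π 1 ∘L V := hV 1
    rw [← hT, this, map_one]
    rfl
  have norm_V : ‖V‖ ≤ 1 := V.opNorm_le_bound zero_le_one fun x => by
    rw [(norm_map_iff_adjoint_comp_self V).2 adjoint_comp_self, one_mul]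
  exact ⟨K, _, _, _, V, π, adjoint_comp_self, norm_V, hπ, hV⟩

theorem norm_completelyPositiveMap_le (hT : T 1 = 1) (a : A) : ‖T a‖ ≤ ‖a‖ := by
  obtain ⟨K, _, _, _, V, π, -, norm_V, hπ, hV⟩ := exists_isometry_dilation hT
  rw [hV]
  calc ‖adjoint V ∘L π a ∘L V‖ ≤ ‖adjoint V‖ * (‖π a‖ * ‖V‖) :=
        (opNorm_comp_le _ _).trans (by gcongr; exact opNorm_comp_le _ _)
    _ ≤ 1 * (‖a‖ * 1) := by
        rw [LinearIsometryEquiv.norm_map]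
        gcongr
        exact hπ a
    _ = ‖a‖ := by ring

theorem isStarProjection_one_sub_comp_adjoint {K : Type*} [NormedAddCommGroup K]
    [InnerProductSpace ℂ K] [CompleteSpace K] {V : H →L[ℂ] K} (hV : adjoint V ∘L V = 1) :
    IsStarProjection (1 - V ∘L adjoint V) := by
  refine IsStarProjection.one_sub ⟨?_, ?_⟩
  · change (V ∘L adjoint V) ∘L (V ∘L adjoint V) = _
    rw [comp_assoc, ← comp_assoc (adjoint V), hV]
    rfl
  · rw [isSelfAdjoint_iff', adjoint_comp, adjoint_adjoint]

/-- In terms of an isometric dilation `T = V* π(·) V`, one takes `Q a = (1 - V V*) π(a) V`. -/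
theorem exists_defectMap (hT : T 1 = 1) :
    ∃ (K : Type (max u v)) (_ : NormedAddCommGroup K) (_ : InnerProductSpace ℂ K)
      (_ : CompleteSpace K) (Q : A →ₗ[ℂ] (H →L[ℂ] K)),
      (∀ a b, T (star a * b) - star (T a) * T b = adjoint (Q a) ∘L Q b) ∧
      ∀ a b, ‖Q (a * b)‖ ≤ ‖a‖ * ‖Q b‖ + ‖Q a‖ * ‖b‖ := by
  obtain ⟨K, _, _, _, V, π, adjoint_comp_self, -, hπ, hV⟩ := exists_isometry_dilation hT
  let q : K →L[ℂ] K := 1 - V ∘L adjoint V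
  have hq : IsStarProjection q := isStarProjection_one_sub_comp_adjoint adjoint_comp_self
  let Q : A →ₗ[ℂ] (H →L[ℂ] K) :=
    { toFun a := q ∘L π a ∘L V
      map_add' a b := by simp only [map_add, add_comp, comp_add]
      map_smul' c a := by simp only [map_smul, smul_comp, comp_smul, RingHom.id_apply] }
  have Q_mul (a b : A) : Q (a * b) = q ∘L π a ∘L Q b + Q a ∘L T b := by
    ext x
    simp [Q, q, hV]
  refine ⟨K, inferInstance, inferInstance, inferInstance, Q, fun a b => ?_, fun a b => ?_⟩
  · ext x
    refine ext_inner_left ℂ fun y => ?_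
    have inner_q (z w : K) : ⟪q z, q w⟫ = ⟪z, w⟫ - ⟪adjoint V z, adjoint V w⟫ := by
      rw [← adjoint_inner_right, hq.isSelfAdjoint.adjoint_eq, ← mul_apply_eq_comp,
        hq.isIdempotentElem, sub_apply, inner_sub_right, adjoint_inner_left]
      rfl
    have inner_map : ⟪y, T (star a * b) x⟫ = ⟪π a (V y), π b (V x)⟫ := by
      rw [hV, map_mul, map_star, star_eq_adjoint, comp_apply, comp_apply, adjoint_inner_right,
        mul_apply_eq_comp, adjoint_inner_right]
    calc ⟪y, (T (star a * b) - star (T a) * T b) x⟫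
        = ⟪π a (V y), π b (V x)⟫ - ⟪T a y, T b x⟫ := by
          rw [sub_apply, inner_sub_right, inner_map, mul_apply_eq_comp, star_eq_adjoint,
            adjoint_inner_right]
      _ = ⟪Q a y, Q b x⟫ := by
          rw [hV, hV]
          exact (inner_q _ _).symm
      _ = ⟪y, (adjoint (Q a) ∘L Q b) x⟫ := by rw [comp_apply, adjoint_inner_right]
  · rw [Q_mul]
    refine (norm_add_le _ _).trans (add_le_add ?_ ?_)
    · calc ‖q ∘L π a ∘L Q b‖ ≤ ‖q‖ * (‖π a‖ * ‖Q b‖) :=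
            (opNorm_comp_le _ _).trans (by gcongr; exact opNorm_comp_le _ _)
        _ ≤ 1 * (‖a‖ * ‖Q b‖) := by
            gcongr
            exacts [hq.norm_le, hπ a]
        _ = ‖a‖ * ‖Q b‖ := one_mul _
    · refine (opNorm_comp_le _ _).trans ?_
      gcongr
      exact norm_completelyPositiveMap_le hT b

theorem multiplicativityDefect_eq_norm {K : Type*} [NormedAddCommGroup K]
    [InnerProductSpace ℂ K] [CompleteSpace K] {Q : A →ₗ[ℂ] (H →L[ℂ] K)}
    (hQ : ∀ a b, T (star a * b) - star (T a) * T b = adjoint (Q a) ∘L Q b) (a : A) :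
    multiplicativityDefect T a = ‖Q a‖ := by
  rw [multiplicativityDefect, hQ, norm_adjoint_comp_self, Real.sqrt_mul_self (norm_nonneg _)]

theorem multiplicativityDefect_nonneg (a : A) : 0 ≤ multiplicativityDefect T a :=
  Real.sqrt_nonneg _

theorem multiplicativityDefect_sq (a : A) :
    multiplicativityDefect T a ^ 2 = ‖T (star a * a) - star (T a) * T a‖ :=
  Real.sq_sqrt (norm_nonneg _)

theorem multiplicativityDefect_add_le (hT : T 1 = 1) (a b : A) :
    multiplicativityDefect T (a + b) ≤ multiplicativityDefect T a + multiplicativityDefect T b := by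
  obtain ⟨K, _, _, _, Q, hQ, -⟩ := exists_defectMap hT
  simpa only [multiplicativityDefect_eq_norm hQ, map_add] using norm_add_le _ _

theorem multiplicativityDefect_smul (hT : T 1 = 1) (c : ℂ) (a : A) :
    multiplicativityDefect T (c • a) = ‖c‖ * multiplicativityDefect T a := by
  obtain ⟨K, _, _, _, Q, hQ, -⟩ := exists_defectMap hT
  simp only [multiplicativityDefect_eq_norm hQ, map_smul, norm_smul]

theorem multiplicativityDefect_mul_le (hT : T 1 = 1) (a b : A) :
    multiplicativityDefect T (a * b) ≤
      ‖a‖ * multiplicativityDefect T b + multiplicativityDefect T a * ‖b‖ := by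
  obtain ⟨K, _, _, _, Q, hQ, hmul⟩ := exists_defectMap hT
  simpa only [multiplicativityDefect_eq_norm hQ] using hmul a b

theorem norm_map_star_mul_sub_le (hT : T 1 = 1) (a b : A) :
    ‖T (star a * b) - star (T a) * T b‖ ≤
      multiplicativityDefect T a * multiplicativityDefect T b := by
  obtain ⟨K, _, _, _, Q, hQ, -⟩ := exists_defectMap hT
  rw [multiplicativityDefect_eq_norm hQ, multiplicativityDefect_eq_norm hQ, hQ,
    ← LinearIsometryEquiv.norm_map adjoint (Q a)]
  exact opNorm_comp_le _ _

end CompletelyPositive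

/-- A form of Dini's theorem; the index set need not be countable. -/
theorem tendsto_intervalIntegral_zero_of_antitone {ι : Type*} [Preorder ι] {F : ι → ℝ → ℝ}
    (hF : ∀ i, Continuous (F i)) (hF_anti : ∀ r, Antitone fun i => F i r)
    (hF_lim : ∀ r, Tendsto (fun i => F i r) atTop (𝓝 0)) (a b : ℝ) :
    Tendsto (fun i => ∫ r in a..b, F i r) atTop (𝓝 0) := by
  have huniform : TendstoUniformlyOn F (fun _ => 0) atTop (Set.uIcc a b) :=
    Antitone.tendstoUniformlyOn_of_forall_tendsto isCompact_uIcc (fun i => (hF i).continuousOn)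
      (fun r _ => hF_anti r) continuousOn_const fun r _ => hF_lim r
  rw [Metric.tendstoUniformlyOn_iff] at huniform
  rw [Metric.tendsto_nhds]
  intro ε hε
  filter_upwards [huniform (ε / (|b - a| + 1)) (by positivity)] with i hi
  have norm_le (r : ℝ) (hr : r ∈ Set.uIoc a b) : ‖F i r‖ ≤ ε / (|b - a| + 1) := by
    simpa only [dist_zero_left] using (hi r (Set.uIoc_subset_uIcc hr)).le
  rw [dist_zero_right]
  calc ‖∫ r in a..b, F i r‖ ≤ ε / (|b - a| + 1) * |b - a| :=
        intervalIntegral.norm_integral_le_of_norm_le_const norm_le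
    _ < ε := by
        rw [div_mul_eq_mul_div, div_lt_iff₀ (by positivity)]
        nlinarith

theorem isNormalFunctional_inner_of_self {H : Type u} [NormedAddCommGroup H]
    [InnerProductSpace ℂ H] [CompleteSpace H] {Φ : (H →L[ℂ] H) → (H →L[ℂ] H)}
    (hΦ : ∀ x, IsNormalFunctional fun A => ⟪x, Φ A x⟫) (x y : H) :
    IsNormalFunctional fun A => ⟪x, Φ A y⟫ := by
  have polarization (A : H →L[ℂ] H) : ⟪x, Φ A y⟫ =
      1 / 4 * ⟪y + x, Φ A (y + x)⟫ + -1 / 4 * ⟪y - x, Φ A (y - x)⟫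
        + Complex.I / 4 * ⟪y + Complex.I • x, Φ A (y + Complex.I • x)⟫
        + -Complex.I / 4 * ⟪y - Complex.I • x, Φ A (y - Complex.I • x)⟫ := by
    have := inner_map_polarization (adjoint (Φ A) : H →ₗ[ℂ] H) y x
    simp only [coe_coe, adjoint_inner_left] at this
    rw [this]
    ring
  simp only [polarization]
  exact ((((hΦ _).const_mul _).add ((hΦ _).const_mul _)).add ((hΦ _).const_mul _)).add
    ((hΦ _).const_mul _)

namespace QuantumMarkovSemigroup

open scoped ComplexOrder

variable {H : Type u} [NormedAddCommGroup H] [InnerProductSpace ℂ H] [CompleteSpace H]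
  (S : QuantumMarkovSemigroup H)

theorem norm_apply_le (t : ℝ≥0) (A : H →L[ℂ] H) : ‖S.T t A‖ ≤ ‖A‖ :=
  norm_completelyPositiveMap_le (S.map_one t) A

theorem apply_nonneg (t : ℝ≥0) {A : H →L[ℂ] H} (hA : 0 ≤ A) : 0 ≤ S.T t A := by
  simpa only [map_zero] using OrderHomClass.mono (S.T t) hA

theorem isNormalFunctional_inner_apply (t : ℝ≥0) (x y : H) :
    IsNormalFunctional fun A => ⟪x, S.T t A y⟫ :=
  @Continuous.comp _ _ _ (sigmaWeakTopology H) (sigmaWeakTopology H) _ _ _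
    (isNormalFunctional_inner x y) (S.sigmaWeak_continuous t)

theorem continuous_inner_orbit (A : H →L[ℂ] H) (x y : H) :
    Continuous fun r : ℝ => ⟪x, S.T r.toNNReal A y⟫ :=
  Continuous.comp (g := fun t : ℝ≥0 => ⟪x, S.T t A y⟫)
    (@Continuous.comp _ _ _ _ (sigmaWeakTopology H) _ _ _ (isNormalFunctional_inner x y)
      (S.time_continuous A)) continuous_real_toNNReal

theorem intervalIntegrable_inner_orbit (A : H →L[ℂ] H) (x y : H) (a b : ℝ) :
    IntervalIntegrable (fun r : ℝ => ⟪x, S.T r.toNNReal A y⟫) MeasureTheory.volume a b :=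
  (S.continuous_inner_orbit A x y).intervalIntegrable a b

theorem norm_integral_inner_orbit_le (s : ℝ≥0) (A : H →L[ℂ] H) (x y : H) :
    ‖∫ r in (0 : ℝ)..s, ⟪x, S.T r.toNNReal A y⟫‖ ≤ s * ‖A‖ * ‖x‖ * ‖y‖ := by
  have norm_le (r : ℝ) : ‖⟪x, S.T r.toNNReal A y⟫‖ ≤ ‖A‖ * ‖x‖ * ‖y‖ :=
    calc ‖⟪x, S.T r.toNNReal A y⟫‖ ≤ ‖x‖ * ‖S.T r.toNNReal A y‖ := norm_inner_le_norm _ _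
      _ ≤ ‖x‖ * (‖A‖ * ‖y‖) := by
          gcongr
          exact (S.T _ A).le_of_opNorm_le (S.norm_apply_le _ A) y
      _ = ‖A‖ * ‖x‖ * ‖y‖ := by ring
  refine (intervalIntegral.norm_integral_le_of_norm_le_const fun r _ => norm_le r).trans_eq ?_
  rw [sub_zero, abs_of_nonneg s.coe_nonneg]
  ring

/-- The operator `∫₀ˢ T_r A dr`, as a weak integral. -/
noncomputable def timeIntegral (s : ℝ≥0) (A : H →L[ℂ] H) : H →L[ℂ] H :=
  operatorOfForm (𝕜 := ℂ)
    (.mk₂'ₛₗ (starRingEnd ℂ) (.id ℂ) (fun x y => ∫ r in (0 : ℝ)..s, ⟪x, S.T r.toNNReal A y⟫)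
      (fun x x' y => by
        simp only [inner_add_left]
        exact intervalIntegral.integral_add (S.intervalIntegrable_inner_orbit A x y 0 s)
          (S.intervalIntegrable_inner_orbit A x' y 0 s))
      (fun c x y => by
        simp only [inner_smul_left]
        exact intervalIntegral.integral_const_mul _ _)
      (fun x y y' => by
        simp only [map_add, inner_add_right]
        exact intervalIntegral.integral_add (S.intervalIntegrable_inner_orbit A x y 0 s)
          (S.intervalIntegrable_inner_orbit A x y' 0 s))
      (fun c x y => by
        simp only [map_smul, inner_smul_right]
        exact intervalIntegral.integral_const_mul _ _))
    (M := s * ‖A‖) (S.norm_integral_inner_orbit_le s A)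

theorem inner_timeIntegral (s : ℝ≥0) (A : H →L[ℂ] H) (x y : H) :
    ⟪x, S.timeIntegral s A y⟫ = ∫ r in (0 : ℝ)..s, ⟪x, S.T r.toNNReal A y⟫ :=
  inner_operatorOfForm _ _ _ _

theorem norm_timeIntegral_le (s : ℝ≥0) (A : H →L[ℂ] H) : ‖S.timeIntegral s A‖ ≤ s * ‖A‖ := by
  refine opNorm_le_of_re_inner_le (𝕜 := ℂ) (by positivity) fun y x hy hx => ?_
  rw [inner_re_symm]
  refine (RCLike.re_le_norm _).trans ?_
  simpa only [inner_timeIntegral, hx, hy, mul_one] using S.norm_integral_inner_orbit_le s A x y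

theorem timeIntegral_add (s : ℝ≥0) (A B : H →L[ℂ] H) :
    S.timeIntegral s (A + B) = S.timeIntegral s A + S.timeIntegral s B := by
  ext y
  refine ext_inner_left ℂ fun x => ?_
  simp only [add_apply, inner_add_right, inner_timeIntegral, map_add]
  exact intervalIntegral.integral_add (S.intervalIntegrable_inner_orbit A x y 0 s)
    (S.intervalIntegrable_inner_orbit B x y 0 s)

theorem timeIntegral_smul (s : ℝ≥0) (c : ℂ) (A : H →L[ℂ] H) :
    S.timeIntegral s (c • A) = c • S.timeIntegral s A := by
  ext y
  refine ext_inner_left ℂ fun x => ?_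
  simp only [smul_apply, inner_smul_right, inner_timeIntegral, map_smul]
  exact intervalIntegral.integral_const_mul _ _

theorem inner_timeIntegral_self (s : ℝ≥0) (x : H) {A : H →L[ℂ] H} (hA : 0 ≤ A) :
    ⟪x, S.timeIntegral s A x⟫ = (∫ r in (0 : ℝ)..s, (⟪x, S.T r.toNNReal A x⟫).re : ℝ) := by
  rw [inner_timeIntegral, ← intervalIntegral.integral_ofReal]
  refine intervalIntegral.integral_congr fun r _ => Complex.eq_re_of_ofReal_le (r := 0) ?_
  exact ((nonneg_iff_isPositive _).1 (S.apply_nonneg _ hA)).inner_nonneg_right x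

/-- The positive functional `A ↦ ∫₀ˢ ⟨x, T_r A x⟩ dr`. -/
noncomputable def timeIntegralFunctional (s : ℝ≥0) (x : H) : (H →L[ℂ] H) →ₚ[ℂ] ℂ :=
  PositiveLinearMap.mk₀
    { toFun A := ⟪x, S.timeIntegral s A x⟫
      map_add' A B := by rw [timeIntegral_add, add_apply, inner_add_right]
      map_smul' c A := by
        rw [timeIntegral_smul, smul_apply, inner_smul_right, RingHom.id_apply, smul_eq_mul] }
    fun A hA => by
      change 0 ≤ ⟪x, S.timeIntegral s A x⟫
      rw [S.inner_timeIntegral_self s x hA, Complex.zero_le_real]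
      exact intervalIntegral.integral_nonneg s.coe_nonneg fun r _ =>
        ((nonneg_iff_isPositive _).1 (S.apply_nonneg _ hA)).re_inner_nonneg_right x

theorem isNormalFunctional_timeIntegralFunctional (s : ℝ≥0) (x : H) :
    IsNormalFunctional (S.timeIntegralFunctional s x) := by
  obtain ⟨w, b, -⟩ := exists_hilbertBasis ℂ H
  refine isNormalFunctional_of_tendsto_finiteProjection b _ ?_
  have tendsto_re_integral : Tendsto (fun F => ∫ r in (0 : ℝ)..s,
      (⟪x, S.T r.toNNReal (1 - finiteProjection b F) x⟫).re) atTop (𝓝 0) := by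
    refine tendsto_intervalIntegral_zero_of_antitone
      (F := fun F r => (⟪x, S.T r.toNNReal (1 - finiteProjection b F) x⟫).re)
      (fun F => Complex.continuous_re.comp (S.continuous_inner_orbit _ x x))
      (fun r F F' hF => ?_) (fun r => ?_) 0 s
    · have map_le := OrderHomClass.mono (S.T r.toNNReal)
        (sub_le_sub_left (finiteProjection_mono b hF) 1)
      have re_inner_nonneg := ((le_def _ _).1 map_le).re_inner_nonneg_right x
      rwa [sub_apply, inner_sub_right, map_sub, sub_nonneg] at re_inner_nonneg
    · have tendsto_inner := (S.isNormalFunctional_inner_apply r.toNNReal x x).tendsto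
        (sigmaWeakTendsto_one_sub_finiteProjection b)
      simpa only [map_zero, zero_apply, inner_zero_right, Complex.zero_re, Function.comp_def] using
        (Complex.continuous_re.tendsto _).comp tendsto_inner
  have one_sub_nonneg (F : Finset w) : 0 ≤ 1 - finiteProjection b F :=
    (isStarProjection_finiteProjection b F).one_sub.nonneg
  refine ((Complex.continuous_ofReal.tendsto 0).comp tendsto_re_integral).congr fun F => ?_
  exact (S.inner_timeIntegral_self s x (one_sub_nonneg F)).symm

theorem isNormalFunctional_inner_timeIntegral (s : ℝ≥0) (x y : H) :
    IsNormalFunctional fun A => ⟪x, S.timeIntegral s A y⟫ :=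
  isNormalFunctional_inner_of_self (S.isNormalFunctional_timeIntegralFunctional s) x y

theorem timeIntegral_T_apply (s t : ℝ≥0) (A : H →L[ℂ] H) :
    S.timeIntegral s (S.T t A) = S.timeIntegral (s + t) A - S.timeIntegral t A := by
  ext y
  refine ext_inner_left ℂ fun x => ?_
  have shift : ∫ r in (0 : ℝ)..s, ⟪x, S.T r.toNNReal (S.T t A) y⟫
      = ∫ r in (0 + t : ℝ)..s + t, ⟪x, S.T r.toNNReal A y⟫ := by
    rw [← intervalIntegral.integral_comp_add_right (fun r : ℝ => ⟪x, S.T r.toNNReal A y⟫)]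
    refine intervalIntegral.integral_congr fun r hr => ?_
    rw [Set.uIcc_of_le s.coe_nonneg] at hr
    simp only [← S.map_time_add, Real.toNNReal_add hr.1 t.coe_nonneg, Real.toNNReal_coe]
  rw [sub_apply, inner_sub_right, inner_timeIntegral, inner_timeIntegral, inner_timeIntegral,
    shift, zero_add, NNReal.coe_add]
  exact (intervalIntegral.integral_interval_sub_left (S.intervalIntegrable_inner_orbit A x y _ _)
    (S.intervalIntegrable_inner_orbit A x y _ _)).symm

theorem timeIntegral_sub (s : ℝ≥0) (A B : H →L[ℂ] H) :
    S.timeIntegral s (A - B) = S.timeIntegral s A - S.timeIntegral s B := by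
  rw [eq_sub_iff_add_eq, ← timeIntegral_add, sub_add_cancel]

theorem timeIntegral_T_apply_sub (s t : ℝ≥0) (A : H →L[ℂ] H) :
    S.timeIntegral s (S.T t A - A) = S.timeIntegral t (S.T s A - A) := by
  rw [timeIntegral_sub, timeIntegral_sub, timeIntegral_T_apply, timeIntegral_T_apply, add_comm s t]
  abel

theorem tendsto_inv_smul_timeIntegral (A : H →L[ℂ] H) :
    SigmaWeakTendsto (fun t : ℝ≥0 => ((t : ℝ) : ℂ)⁻¹ • S.timeIntegral t A) (𝓝[>] 0) A := by
  refine sigmaWeakTendsto_of_bounded (M := ‖A‖) ?_ fun x y => ?_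
  · filter_upwards [self_mem_nhdsWithin] with t ht
    have ht_pos : (0 : ℝ) < t := NNReal.coe_pos.2 ht
    rw [norm_smul, norm_inv, Complex.norm_real, NNReal.norm_eq, inv_mul_le_iff₀ ht_pos]
    exact S.norm_timeIntegral_le t A
  · have slope := ((S.continuous_inner_orbit A x y).integral_hasStrictDerivAt 0 0)
      |>.hasDerivAt.tendsto_slope_zero_right
    have coe_tendsto : Tendsto (fun t : ℝ≥0 => (t : ℝ)) (𝓝[>] 0) (𝓝[>] 0) :=
      tendsto_nhdsWithin_iff.2 ⟨(NNReal.continuous_coe.tendsto 0).mono_left nhdsWithin_le_nhds,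
        eventually_mem_nhdsWithin.mono fun _ => NNReal.coe_pos.2⟩
    simpa [Function.comp_def, inner_smul_right, inner_timeIntegral, S.map_time_zero] using
      slope.comp coe_tendsto

end QuantumMarkovSemigroup

namespace QuantumMarkovSemigroup

variable {H : Type u} [NormedAddCommGroup H] [InnerProductSpace ℂ H] [CompleteSpace H]
  {S : QuantumMarkovSemigroup H}

section Generator

theorem sub_eq_timeIntegral_of_tendsto {l : Filter ℝ≥0} [l.NeBot] (hl : l ≤ 𝓝[>] 0)
    {A B : H →L[ℂ] H}
    (hAB : SigmaWeakTendsto (fun t : ℝ≥0 => ((t : ℝ) : ℂ)⁻¹ • (S.T t A - A)) l B) (s : ℝ≥0) :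
    S.T s A - A = S.timeIntegral s B := by
  ext y
  refine ext_inner_left ℂ fun x => ?_
  have tendsto_left :=
    SigmaWeakTendsto.inner ((S.tendsto_inv_smul_timeIntegral (S.T s A - A)).mono_left hl) x y
  have tendsto_right := (S.isNormalFunctional_inner_timeIntegral s x y).tendsto hAB
  refine tendsto_nhds_unique tendsto_left (tendsto_right.congr fun t => ?_)
  rw [timeIntegral_smul, timeIntegral_T_apply_sub]

theorem hasGeneratorAt_iff {A B : H →L[ℂ] H} :
    S.HasGeneratorAt A B ↔ ∀ s, S.T s A - A = S.timeIntegral s B :=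
  ⟨sub_eq_timeIntegral_of_tendsto le_rfl, fun h => by
    simpa only [HasGeneratorAt, h] using S.tendsto_inv_smul_timeIntegral B⟩

/-- The domain of the generator is the Favard class of the semigroup. -/
theorem mem_generator_domain_iff {A : H →L[ℂ] H} :
    A ∈ S.generator.domain ↔ ∃ M : ℝ, ∀ t : ℝ≥0, ‖S.T t A - A‖ ≤ M * t := by
  refine ⟨fun ⟨B, hB⟩ => ⟨‖B‖, fun t => ?_⟩, fun ⟨M, hM⟩ => ?_⟩
  · rw [hasGeneratorAt_iff.1 hB, mul_comm]
    exact S.norm_timeIntegral_le t B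
  · let l := Ultrafilter.of (𝓝[>] (0 : ℝ≥0))
    have hl : (l : Filter ℝ≥0) ≤ 𝓝[>] 0 := Ultrafilter.of_le _
    have norm_quotient_le :
        ∀ᶠ t : ℝ≥0 in 𝓝[>] 0, ‖((t : ℝ) : ℂ)⁻¹ • (S.T t A - A)‖ ≤ M := by
      filter_upwards [self_mem_nhdsWithin] with t ht
      have ht_pos : (0 : ℝ) < t := NNReal.coe_pos.2 ht
      rw [norm_smul, norm_inv, Complex.norm_real, NNReal.norm_eq, inv_mul_le_iff₀ ht_pos, mul_comm]
      exact hM t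
    obtain ⟨B, hB⟩ := exists_sigmaWeakTendsto_of_ultrafilter l (hl norm_quotient_le)
    exact ⟨B, hasGeneratorAt_iff.2 (sub_eq_timeIntegral_of_tendsto hl hB)⟩

theorem eq_zero_of_tendsto_of_hasGeneratorAt {ι : Type*} {l : Filter ι} [l.NeBot]
    {A B : ι → H →L[ℂ] H} {C : H →L[ℂ] H} (hAB : ∀ i, S.HasGeneratorAt (A i) (B i))
    (hA : SigmaWeakTendsto A l 0) (hB : SigmaWeakTendsto B l C) : C = 0 := by
  have timeIntegral_eq_zero (s : ℝ≥0) : S.timeIntegral s C = 0 := by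
    ext y
    refine ext_inner_left ℂ fun x => ?_
    have tendsto_left := (S.isNormalFunctional_inner_timeIntegral s x y).tendsto hB
    have tendsto_right := ((S.isNormalFunctional_inner_apply s x y).tendsto hA).sub (hA.inner x y)
    simp only [map_zero, zero_apply, inner_zero_right, sub_self] at tendsto_right ⊢
    refine tendsto_nhds_unique tendsto_left (tendsto_right.congr fun i => ?_)
    rw [← inner_sub_right, ← sub_apply, hasGeneratorAt_iff.1 (hAB i)]
  have hC : S.HasGeneratorAt 0 C := hasGeneratorAt_iff.2 fun s => by
    rw [map_zero, sub_zero, timeIntegral_eq_zero]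
  exact hC.unique hasGeneratorAt_zero

theorem HasGeneratorAt.star {A B : H →L[ℂ] H} (h : S.HasGeneratorAt A B) :
    S.HasGeneratorAt (star A) (star B) := by
  refine (SigmaWeakTendsto.star h).congr fun t => ?_
  have map_star : S.T t (Star.star A) = Star.star (S.T t A) :=
    (isDilatable_completelyPositiveMap (S.T t)).map_star A
  rw [star_smul, star_sub, ← map_star]
  simp

theorem star_mem_generator_domain {A : H →L[ℂ] H} (hA : A ∈ S.generator.domain) :
    star A ∈ S.generator.domain :=
  ⟨_, (S.generator_spec ⟨A, hA⟩).star⟩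

theorem algebraMap_mem_generator_domain (c : ℂ) :
    algebraMap ℂ (H →L[ℂ] H) c ∈ S.generator.domain :=
  mem_generator_domain_iff.2 ⟨0, fun t => by
    simp [Algebra.algebraMap_eq_smul_one, S.map_one]⟩

end Generator

section DomainAlgebra

variable (S) in
/-- The squared defect of multiplicativity of `T t` at `A` is `O(t)`. For `A ∈ D(L)` this means
that the carré du champ is defined at `A`. -/
def HasLinearDefect (A : H →L[ℂ] H) : Prop :=
  ∃ M : ℝ, ∀ t : ℝ≥0, multiplicativityDefect (S.T t) A ^ 2 ≤ M * t

theorem exists_norm_star_mul_sub_le {A B : H →L[ℂ] H} (hA : A ∈ S.generator.domain)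
    (hB : B ∈ S.generator.domain) :
    ∃ M : ℝ, ∀ t : ℝ≥0, ‖star (S.T t A) * S.T t B - star A * B‖ ≤ M * t := by
  obtain ⟨a, ha⟩ := mem_generator_domain_iff.1 hA
  obtain ⟨b, hb⟩ := mem_generator_domain_iff.1 hB
  refine ⟨a * ‖B‖ + ‖A‖ * b, fun t => ?_⟩
  calc ‖star (S.T t A) * S.T t B - star A * B‖
      = ‖star (S.T t A - A) * S.T t B + star A * (S.T t B - B)‖ := by
        rw [star_sub]
        noncomm_ring
    _ ≤ ‖S.T t A - A‖ * ‖S.T t B‖ + ‖A‖ * ‖S.T t B - B‖ := by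
        refine (norm_add_le_of_le (norm_mul_le _ _) (norm_mul_le _ _)).trans_eq ?_
        rw [norm_star, norm_star]
    _ ≤ a * t * ‖B‖ + ‖A‖ * (b * t) := by
        gcongr
        · exact (norm_nonneg _).trans (ha t)
        · exact ha t
        · exact S.norm_apply_le t B
        · exact hb t
    _ = (a * ‖B‖ + ‖A‖ * b) * t := by ring

theorem star_mul_mem_generator_domain {A B : H →L[ℂ] H} (hA : A ∈ S.generator.domain)
    (hB : B ∈ S.generator.domain) (hdA : S.HasLinearDefect A) (hdB : S.HasLinearDefect B) :
    star A * B ∈ S.generator.domain := by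
  obtain ⟨M, hM⟩ := exists_norm_star_mul_sub_le hA hB
  obtain ⟨a, ha⟩ := hdA
  obtain ⟨b, hb⟩ := hdB
  refine mem_generator_domain_iff.2 ⟨(a + b) / 2 + M, fun t => ?_⟩
  calc ‖S.T t (star A * B) - star A * B‖
      ≤ ‖S.T t (star A * B) - star (S.T t A) * S.T t B‖
        + ‖star (S.T t A) * S.T t B - star A * B‖ := norm_sub_le_norm_sub_add_norm_sub _ _ _
    _ ≤ multiplicativityDefect (S.T t) A * multiplicativityDefect (S.T t) B + M * t :=
        add_le_add (norm_map_star_mul_sub_le (S.map_one t) A B) (hM t)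
    _ ≤ ((a + b) / 2 + M) * t := by
        linarith [ha t, hb t, two_mul_le_add_sq (multiplicativityDefect (S.T t) A)
          (multiplicativityDefect (S.T t) B)]

theorem hasLinearDefect_iff {A : H →L[ℂ] H} (hA : A ∈ S.generator.domain) :
    S.HasLinearDefect A ↔ star A * A ∈ S.generator.domain := by
  refine ⟨fun h => star_mul_mem_generator_domain hA hA h h, fun h => ?_⟩
  obtain ⟨a, ha⟩ := mem_generator_domain_iff.1 h
  obtain ⟨b, hb⟩ := exists_norm_star_mul_sub_le hA hA
  refine ⟨a + b, fun t => ?_⟩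
  calc multiplicativityDefect (S.T t) A ^ 2
      = ‖S.T t (star A * A) - star (S.T t A) * S.T t A‖ := multiplicativityDefect_sq A
    _ ≤ ‖S.T t (star A * A) - star A * A‖ + ‖star (S.T t A) * S.T t A - star A * A‖ := by
        rw [norm_sub_rev (star (S.T t A) * _)]
        exact norm_sub_le_norm_sub_add_norm_sub _ _ _
    _ ≤ (a + b) * t := by
        rw [add_mul]
        exact add_le_add (ha t) (hb t)

theorem HasLinearDefect.add {A B : H →L[ℂ] H} (hA : S.HasLinearDefect A)
    (hB : S.HasLinearDefect B) : S.HasLinearDefect (A + B) := by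
  obtain ⟨a, ha⟩ := hA
  obtain ⟨b, hb⟩ := hB
  refine ⟨2 * (a + b), fun t => ?_⟩
  calc multiplicativityDefect (S.T t) (A + B) ^ 2
      ≤ (multiplicativityDefect (S.T t) A + multiplicativityDefect (S.T t) B) ^ 2 := by
        gcongr
        · exact multiplicativityDefect_nonneg _
        · exact multiplicativityDefect_add_le (S.map_one t) A B
    _ ≤ 2 * (multiplicativityDefect (S.T t) A ^ 2 + multiplicativityDefect (S.T t) B ^ 2) :=
        add_sq_le
    _ ≤ 2 * (a + b) * t := by linarith [ha t, hb t]

theorem HasLinearDefect.mul {A B : H →L[ℂ] H} (hA : S.HasLinearDefect A)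
    (hB : S.HasLinearDefect B) : S.HasLinearDefect (A * B) := by
  obtain ⟨a, ha⟩ := hA
  obtain ⟨b, hb⟩ := hB
  refine ⟨2 * (‖A‖ ^ 2 * b + a * ‖B‖ ^ 2), fun t => ?_⟩
  calc multiplicativityDefect (S.T t) (A * B) ^ 2
      ≤ (‖A‖ * multiplicativityDefect (S.T t) B + multiplicativityDefect (S.T t) A * ‖B‖) ^ 2 := by
        gcongr
        · exact multiplicativityDefect_nonneg _
        · exact multiplicativityDefect_mul_le (S.map_one t) A B
    _ ≤ 2 * (‖A‖ ^ 2 * multiplicativityDefect (S.T t) B ^ 2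
          + multiplicativityDefect (S.T t) A ^ 2 * ‖B‖ ^ 2) := by
        simpa only [mul_pow] using add_sq_le (a := ‖A‖ * multiplicativityDefect (S.T t) B)
          (b := multiplicativityDefect (S.T t) A * ‖B‖)
    _ ≤ 2 * (‖A‖ ^ 2 * (b * t) + a * t * ‖B‖ ^ 2) := by
        gcongr
        · exact hb t
        · exact ha t
    _ = 2 * (‖A‖ ^ 2 * b + a * ‖B‖ ^ 2) * t := by ring

theorem hasLinearDefect_algebraMap (c : ℂ) :
    S.HasLinearDefect (algebraMap ℂ (H →L[ℂ] H) c) := by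
  refine ⟨0, fun t => ?_⟩
  rw [Algebra.algebraMap_eq_smul_one, multiplicativityDefect_smul (S.map_one t), mul_pow,
    multiplicativityDefect_sq]
  simp [S.map_one]

theorem mem_domainAlgebra_iff {A : H →L[ℂ] H} :
    A ∈ S.domainAlgebra ↔
      A ∈ S.generator.domain ∧ S.HasLinearDefect A ∧ S.HasLinearDefect (star A) := by
  refine and_congr_right fun hA => and_congr (hasLinearDefect_iff hA).symm ?_
  rw [hasLinearDefect_iff (star_mem_generator_domain hA), star_star]
  rfl

variable (S)

/-- The domain algebra of the generator, as a unital `*`-subalgebra of `B(H)`. -/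
def domainStarSubalgebra : StarSubalgebra ℂ (H →L[ℂ] H) where
  carrier := S.domainAlgebra
  mul_mem' {A B} hA hB := by
    rw [mem_domainAlgebra_iff] at *
    obtain ⟨hA, hdA, hdA_star⟩ := hA
    obtain ⟨hB, hdB, hdB_star⟩ := hB
    refine ⟨?_, hdA.mul hdB, ?_⟩
    · simpa only [star_star] using
        star_mul_mem_generator_domain (star_mem_generator_domain hA) hB hdA_star hdB
    · rw [star_mul]
      exact hdB_star.mul hdA_star
  add_mem' {A B} hA hB := by
    rw [mem_domainAlgebra_iff] at *
    rw [star_add]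
    exact ⟨add_mem hA.1 hB.1, hA.2.1.add hB.2.1, hA.2.2.add hB.2.2⟩
  algebraMap_mem' c := by
    rw [mem_domainAlgebra_iff, ← algebraMap_star_comm]
    exact ⟨algebraMap_mem_generator_domain c, hasLinearDefect_algebraMap c,
      hasLinearDefect_algebraMap _⟩
  star_mem' {A} (hA : A ∈ S.domainAlgebra) := by
    change star A ∈ S.domainAlgebra
    rw [mem_domainAlgebra_iff] at *
    rw [star_star]
    exact ⟨star_mem_generator_domain hA.1, hA.2.2, hA.2.1⟩

/-- The generator, restricted to the domain algebra. -/
noncomputable def algebraGenerator : S.domainStarSubalgebra →ₗ[ℂ] (H →L[ℂ] H) where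
  toFun A := S.generator ⟨A, A.2.1⟩
  map_add' A B := S.generator.map_add ⟨A, A.2.1⟩ ⟨B, B.2.1⟩
  map_smul' c A := S.generator.map_smul c ⟨A, A.2.1⟩

theorem hasGeneratorAt_algebraGenerator (A : S.domainStarSubalgebra) :
    S.HasGeneratorAt A (S.algebraGenerator A) :=
  S.generator_spec ⟨A, A.2.1⟩

theorem isSigmaWeaklyClosable_algebraGenerator :
    IsSigmaWeaklyClosable (𝒟 := (S.domainStarSubalgebra : Set (H →L[ℂ] H)))
      S.algebraGenerator := fun _ _ _ =>
  eq_zero_of_tendsto_of_hasGeneratorAt S.hasGeneratorAt_algebraGenerator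

end DomainAlgebra

end QuantumMarkovSemigroup

section LindbladForm

variable {H : Type u} [NormedAddCommGroup H] [InnerProductSpace ℂ H] [CompleteSpace H]

variable {𝒜 : StarSubalgebra ℂ (H →L[ℂ] H)} {k h : H}

variable (𝒜) in
/-- The linear map `A ↦ G A + A G*` on `𝒜`. -/
noncomputable def driftPart (G : H →L[ℂ] H) : 𝒜 →ₗ[ℂ] H →L[ℂ] H :=
  (LinearMap.mulLeft ℂ G + LinearMap.mulRight ℂ (adjoint G)) ∘ₗ 𝒜.subtype.toLinearMap

theorem driftPart_apply (G : H →L[ℂ] H) (A : 𝒜) :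
    driftPart 𝒜 G A = G ∘L (A : H →L[ℂ] H) + (A : H →L[ℂ] H) ∘L adjoint G :=
  rfl

theorem driftPart_star (G : H →L[ℂ] H) (A : 𝒜) :
    driftPart 𝒜 G (star A) = star (driftPart 𝒜 G A) := by
  simp only [driftPart_apply, star_add, star_eq_adjoint, adjoint_comp, adjoint_adjoint,
    StarMemClass.coe_star]
  exact add_comm _ _

theorem gramForm_driftPart (G : H →L[ℂ] H) {ι : Type*} [Fintype ι] (a : ι → 𝒜) (x : ι → H) :
    gramForm (driftPart 𝒜 G) a x =
      2 * (∑ j, ⟪G (adjoint (a j : H →L[ℂ] H) (∑ i, (a i : H →L[ℂ] H) (x i))), x j⟫).re := by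
  let f (i j : ι) : ℂ := ⟪G (adjoint (a j : H →L[ℂ] H) ((a i : H →L[ℂ] H) (x i))), x j⟫
  have inner_eq (i j : ι) : ⟪driftPart 𝒜 G (star (a j) * a i) (x i), x j⟫ =
      f i j + star (f j i) := by
    have coe_eq : ((star (a j) * a i : 𝒜) : H →L[ℂ] H) = adjoint (a j : H →L[ℂ] H) ∘L a i := rfl
    simp only [f, driftPart_apply, coe_eq, add_apply, comp_apply, inner_add_left,
      RCLike.star_def, inner_conj_symm]
    rw [adjoint_inner_left, ← adjoint_inner_right (a i : H →L[ℂ] H), adjoint_inner_left]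
  have re_sum_star : (∑ i, ∑ j, star (f j i)).re = (∑ i, ∑ j, f i j).re := by
    rw [Finset.sum_comm]
    simp only [Complex.re_sum, RCLike.star_def, Complex.conj_re]
  have sum_eq : ∑ i, ∑ j, f i j =
      ∑ j, ⟪G (adjoint (a j : H →L[ℂ] H) (∑ i, (a i : H →L[ℂ] H) (x i))), x j⟫ := by
    rw [Finset.sum_comm]
    simp only [f, map_sum, sum_inner]
  simp only [gramForm, inner_eq, Finset.sum_add_distrib]
  rw [Complex.add_re, re_sum_star, ← sum_eq, two_mul]

variable (𝒜 k) in
/-- The space of all `x` with `|x⟩⟨k| ∈ 𝒜`. -/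
noncomputable def ketSubmodule : Submodule ℂ H :=
  (Subalgebra.toSubmodule 𝒜.toSubalgebra).comap
    ((InnerProductSpace.rankOne ℂ).flip k : H →L[ℂ] H →L[ℂ] H).toLinearMap

theorem apply_mem_ketSubmodule (A : 𝒜) {x : H} (hx : x ∈ ketSubmodule 𝒜 k) :
    (A : H →L[ℂ] H) x ∈ ketSubmodule 𝒜 k := by
  change InnerProductSpace.rankOne ℂ ((A : H →L[ℂ] H) x) k ∈ 𝒜
  rw [← InnerProductSpace.comp_rankOne]
  exact mul_mem A.2 hx

variable (𝒜 k) in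
/-- The linear map `x ↦ |x⟩⟨k|` with values in `𝒜`. -/
noncomputable def ketbra : ketSubmodule 𝒜 k →ₗ[ℂ] 𝒜 where
  toFun x := ⟨InnerProductSpace.rankOne ℂ (x : H) k, x.2⟩
  map_add' x y := Subtype.ext <| by simp
  map_smul' c x := Subtype.ext <| by simp

theorem mul_ketbra (A : 𝒜) (x : ketSubmodule 𝒜 k) :
    A * ketbra 𝒜 k x = ketbra 𝒜 k ⟨(A : H →L[ℂ] H) x, apply_mem_ketSubmodule A x.2⟩ :=
  Subtype.ext <| InnerProductSpace.comp_rankOne _ _ _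

theorem star_ketbra_mul_ketbra (hk : k ∈ ketSubmodule 𝒜 k) (x : ketSubmodule 𝒜 k) :
    star (ketbra 𝒜 k x) * ketbra 𝒜 k x = ⟪(x : H), (x : H)⟫ • ketbra 𝒜 k ⟨k, hk⟩ :=
  Subtype.ext <| by
    change adjoint (InnerProductSpace.rankOne ℂ (x : H) k) ∘L InnerProductSpace.rankOne ℂ (x : H) k
      = ⟪(x : H), (x : H)⟫ • InnerProductSpace.rankOne ℂ k k
    rw [InnerProductSpace.adjoint_rankOne, InnerProductSpace.rankOne_comp_rankOne]

/-- The infinitesimal version of `IsDilatable`, satisfied by generators of semigroups of dilatable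
maps: its inequalities are only required for families with `∑ᵢ aᵢ xᵢ = 0`, on which the Gram form
of the identity vanishes. -/
structure IsConditionallyDilatable (L : 𝒜 →ₗ[ℂ] H →L[ℂ] H) : Prop where
  map_star : ∀ a, L (star a) = star (L a)
  gramForm_nonneg : ∀ {n : ℕ} (a : Fin n → 𝒜) (x : Fin n → H),
    ∑ i, (a i : H →L[ℂ] H) (x i) = 0 → 0 ≤ gramForm L a x
  gramForm_mul_le : ∀ (c : 𝒜) {n : ℕ} (a : Fin n → 𝒜) (x : Fin n → H),
    ∑ i, (a i : H →L[ℂ] H) (x i) = 0 → gramForm L (fun i => c * a i) x ≤ ‖c‖ ^ 2 * gramForm L a x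

variable {L : 𝒜 →ₗ[ℂ] H →L[ℂ] H} {G : H →L[ℂ] H}

theorem gramForm_sub_driftPart (hL : ∀ a, L (star a) = star (L a)) (hk : k ∈ ketSubmodule 𝒜 k)
    (hG : ∀ x : ketSubmodule 𝒜 k,
      G x = L (ketbra 𝒜 k x) h - (⟪L (ketbra 𝒜 k ⟨k, hk⟩) h, h⟫.re / 2 : ℝ) • (x : H))
    {n : ℕ} (a : Fin n → 𝒜) (x : Fin n → H) (u : ketSubmodule 𝒜 k)
    (hu : (u : H) = ∑ i, (a i : H →L[ℂ] H) (x i)) :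
    gramForm (L - driftPart 𝒜 G) a x =
      gramForm L (Fin.cons (ketbra 𝒜 k u) a : Fin (n + 1) → 𝒜)
        (Fin.cons (-h) x : Fin (n + 1) → H) := by
  set r := ⟪L (ketbra 𝒜 k ⟨k, hk⟩) h, h⟫.re with hr
  have re_cross : (∑ j, ⟪L (star (a j) * ketbra 𝒜 k u) (-h), x j⟫).re =
      -((∑ j, ⟪G (adjoint (a j : H →L[ℂ] H) u), x j⟫).re + r / 2 * ‖(u : H)‖ ^ 2) := by
    have inner_eq (j : Fin n) : ⟪L (star (a j) * ketbra 𝒜 k u) (-h), x j⟫ =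
        -(⟪G (adjoint (a j : H →L[ℂ] H) u), x j⟫
          + (r / 2 : ℝ) * ⟪(u : H), (a j : H →L[ℂ] H) (x j)⟫) := by
      rw [mul_ketbra, map_neg, inner_neg_left, ← adjoint_inner_left, ← Complex.conj_ofReal,
        ← inner_smul_left, ← inner_add_left, Complex.coe_smul,
        sub_eq_iff_eq_add.1 (hG ⟨_, _⟩).symm]
      rfl
    simp only [inner_eq, Finset.sum_neg_distrib, Finset.sum_add_distrib, ← Finset.mul_sum,
      ← inner_sum, ← hu, Complex.neg_re, Complex.add_re, Complex.re_ofReal_mul]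
    rw [inner_self_eq_norm_sq_to_K]
    norm_cast
  have re_diag : (⟪L (star (ketbra 𝒜 k u) * ketbra 𝒜 k u) (-h), -h⟫).re = ‖(u : H)‖ ^ 2 * r := by
    rw [star_ketbra_mul_ketbra hk, inner_self_eq_norm_sq_to_K, map_smul, map_neg, inner_neg_neg,
      smul_apply, inner_smul_left, hr, ← Complex.re_ofReal_mul]
    norm_num
  rw [gramForm_sub, gramForm_driftPart, gramForm_cons hL, re_cross, re_diag, ← hu]
  ring

theorem sum_cons_ketbra_apply_eq_zero (hkh : ⟪k, h⟫ = 1) {n : ℕ} (a : Fin n → 𝒜) (x : Fin n → H)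
    (u : ketSubmodule 𝒜 k) (hu : (u : H) = ∑ i, (a i : H →L[ℂ] H) (x i)) :
    ∑ i, ((Fin.cons (ketbra 𝒜 k u) a : Fin (n + 1) → 𝒜) i : H →L[ℂ] H)
      ((Fin.cons (-h) x : Fin (n + 1) → H) i) = 0 := by
  have ketbra_apply : (ketbra 𝒜 k u : H →L[ℂ] H) h = u := by
    change InnerProductSpace.rankOne ℂ (u : H) k h = u
    rw [InnerProductSpace.rankOne_apply, hkh, one_smul]
  simp only [Fin.sum_univ_succ, Fin.cons_zero, Fin.cons_succ, map_neg, ketbra_apply, ← hu,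
    neg_add_cancel]

theorem IsConditionallyDilatable.isDilatable_sub_driftPart (hL : IsConditionallyDilatable L)
    (hkh : ⟪k, h⟫ = 1) (hd : Dense (ketSubmodule 𝒜 k : Set H)) (hk : k ∈ ketSubmodule 𝒜 k)
    (hG : ∀ x : ketSubmodule 𝒜 k,
      G x = L (ketbra 𝒜 k x) h - (⟪L (ketbra 𝒜 k ⟨k, hk⟩) h, h⟫.re / 2 : ℝ) • (x : H)) :
    IsDilatable (L - driftPart 𝒜 G) where
  map_star a := by
    rw [LinearMap.sub_apply, LinearMap.sub_apply, hL.map_star, driftPart_star, star_sub]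
  gramForm_nonneg {n} a x := by
    refine (dense_pi Set.univ fun (_ : Fin n) _ => hd).induction
      (P := fun x => 0 ≤ gramForm (L - driftPart 𝒜 G) a x) (fun x hx => ?_)
      (isClosed_le continuous_const (continuous_gramForm _ a)) x
    let u : ketSubmodule 𝒜 k := ∑ i, ⟨_, apply_mem_ketSubmodule (a i) (hx i trivial)⟩
    have hu : (u : H) = ∑ i, (a i : H →L[ℂ] H) (x i) := by simp [u]
    rw [gramForm_sub_driftPart hL.map_star hk hG a x u hu]
    exact hL.gramForm_nonneg _ _ (sum_cons_ketbra_apply_eq_zero hkh a x u hu)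
  gramForm_mul_le c n a x := by
    refine (dense_pi Set.univ fun (_ : Fin n) _ => hd).induction
      (P := fun x => gramForm (L - driftPart 𝒜 G) (fun i => c * a i) x ≤
        ‖c‖ ^ 2 * gramForm (L - driftPart 𝒜 G) a x) (fun x hx => ?_)
      (isClosed_le (continuous_gramForm _ _) ((continuous_gramForm _ a).const_mul _)) x
    let u : ketSubmodule 𝒜 k := ∑ i, ⟨_, apply_mem_ketSubmodule (a i) (hx i trivial)⟩
    have hu : (u : H) = ∑ i, (a i : H →L[ℂ] H) (x i) := by simp [u]
    have hcu : (c : H →L[ℂ] H) u = ∑ i, ((c * a i : 𝒜) : H →L[ℂ] H) (x i) := by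
      rw [hu, map_sum]
      rfl
    have cons_eq : (Fin.cons (ketbra 𝒜 k ⟨_, apply_mem_ketSubmodule c u.2⟩) fun i => c * a i) =
        fun i => c * (Fin.cons (ketbra 𝒜 k u) a : Fin (n + 1) → 𝒜) i :=
      funext <| Fin.cases (mul_ketbra c u).symm fun _ => rfl
    rw [gramForm_sub_driftPart hL.map_star hk hG a x u hu,
      gramForm_sub_driftPart hL.map_star hk hG _ x ⟨_, apply_mem_ketSubmodule c u.2⟩ hcu, cons_eq]
    exact hL.gramForm_mul_le c _ _ (sum_cons_ketbra_apply_eq_zero hkh a x u hu)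

theorem IsConditionallyDilatable.exists_isDilatable_sub_driftPart
    (hL : IsConditionallyDilatable L) (hkh : ⟪k, h⟫ ≠ 0) (hd : Dense (ketSubmodule 𝒜 k : Set H))
    (hk : k ∈ ketSubmodule 𝒜 k)
    (hbound : ∃ C : ℝ, ∀ x : ketSubmodule 𝒜 k, ‖L (ketbra 𝒜 k x) h‖ ≤ C * ‖(x : H)‖) :
    ∃ G : H →L[ℂ] H, IsDilatable (L - driftPart 𝒜 G) := by
  obtain ⟨C, hC⟩ := hbound
  let h' := ⟪k, h⟫⁻¹ • h
  have hkh' : ⟪k, h'⟫ = 1 := by rw [inner_smul_right, inv_mul_cancel₀ hkh]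
  let f : ketSubmodule 𝒜 k →ₗ[ℂ] H := (apply ℂ H h').toLinearMap ∘ₗ L ∘ₗ ketbra 𝒜 k
  have hf (x : ketSubmodule 𝒜 k) : ‖f x‖ ≤ ‖⟪k, h⟫⁻¹‖ * C * ‖(x : H)‖ := by
    have f_apply : f x = ⟪k, h⟫⁻¹ • L (ketbra 𝒜 k x) h :=
      (L (ketbra 𝒜 k x)).map_smul _ h
    rw [f_apply, norm_smul, mul_assoc]
    gcongr
    exact hC x
  let r := ⟪f ⟨k, hk⟩, h'⟫.re
  refine ⟨f.extendOfNorm (ketSubmodule 𝒜 k).subtype - (r / 2) • 1,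
    hL.isDilatable_sub_driftPart hkh' hd hk fun x => ?_⟩
  have f_extend := LinearMap.extendOfNorm_eq (e := (ketSubmodule 𝒜 k).subtype) hd.denseRange_val
    ⟨_, hf⟩ x
  exact congrArg (· - (r / 2) • (x : H)) f_extend

end LindbladForm

section MainTheorem

variable {H : Type u} [NormedAddCommGroup H] [InnerProductSpace ℂ H] [CompleteSpace H]

namespace QuantumMarkovSemigroup

variable (S : QuantumMarkovSemigroup H)

theorem tendsto_gramForm {ι : Type*} [Fintype ι] (a : ι → S.domainStarSubalgebra) (x : ι → H)
    (hax : ∑ i, (a i : H →L[ℂ] H) (x i) = 0) :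
    Tendsto (fun t : ℝ≥0 => (t : ℝ)⁻¹ * gramForm (S.T t).toLinearMap (fun i => (a i : H →L[ℂ] H)) x)
      (𝓝[>] 0) (𝓝 (gramForm S.algebraGenerator a x)) := by
  let D (t : ℝ≥0) (A : H →L[ℂ] H) : H →L[ℂ] H := ((t : ℝ) : ℂ)⁻¹ • (S.T t A - A)
  have tendsto_sum : Tendsto
      (fun t => (∑ i, ∑ j, ⟪D t (star (a j : H →L[ℂ] H) * a i) (x i), x j⟫).re) (𝓝[>] 0)
      (𝓝 (gramForm S.algebraGenerator a x)) := by
    refine (Complex.continuous_re.tendsto _).comp <|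
      tendsto_finsetSum _ fun i _ => tendsto_finsetSum _ fun j _ => ?_
    simpa only [RCLike.star_def, inner_conj_symm] using! (SigmaWeakTendsto.inner
      (S.hasGeneratorAt_algebraGenerator (star (a j) * a i)) (x j) (x i)).star
  refine tendsto_sum.congr fun t => ?_
  have sum_inner_eq_zero :
      ∑ i, ∑ j, ⟪(star (a j : H →L[ℂ] H) * a i) (x i), x j⟫ = 0 := by
    simp only [mul_apply_eq_comp, star_eq_adjoint, adjoint_inner_left, ← inner_sum, hax,
      inner_zero_right, Finset.sum_const_zero]
  simp only [D, smul_apply, sub_apply, inner_smul_left, inner_sub_left, ← Finset.mul_sum,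
    Finset.sum_sub_distrib, sum_inner_eq_zero, sub_zero, ← Complex.ofReal_inv,
    Complex.conj_ofReal, Complex.re_ofReal_mul]
  rfl

theorem isConditionallyDilatable_algebraGenerator :
    IsConditionallyDilatable S.algebraGenerator where
  map_star A :=
    (S.hasGeneratorAt_algebraGenerator (star A)).unique (S.hasGeneratorAt_algebraGenerator A).star
  gramForm_nonneg a x hax :=
    ge_of_tendsto' (S.tendsto_gramForm a x hax) fun t => mul_nonneg (inv_nonneg.2 t.coe_nonneg)
      ((isDilatable_completelyPositiveMap (S.T t)).gramForm_nonneg _ x)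
  gramForm_mul_le c n a x hax := by
    have hcax : ∑ i, ((c * a i : S.domainStarSubalgebra) : H →L[ℂ] H) (x i) = 0 :=
      (map_sum (c : H →L[ℂ] H) _ _).symm.trans <| (congrArg _ hax).trans (map_zero _)
    refine le_of_tendsto_of_tendsto' (S.tendsto_gramForm _ x hcax)
      ((S.tendsto_gramForm a x hax).const_mul _) fun t => ?_
    rw [mul_left_comm]
    exact mul_le_mul_of_nonneg_left
      ((isDilatable_completelyPositiveMap (S.T t)).gramForm_mul_le c _ x)
      (inv_nonneg.2 t.coe_nonneg)

variable {S}

theorem self_mem_domainVectors {k : H}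
    (hk : InnerProductSpace.rankOne ℂ k k ∈ S.generator.domain) : k ∈ S.domainVectors k := by
  refine ⟨hk, ?_, ?_⟩ <;>
  · rw [InnerProductSpace.adjoint_rankOne, InnerProductSpace.rankOne_comp_rankOne]
    exact Submodule.smul_mem _ _ hk

end QuantumMarkovSemigroup

theorem proposition5p2_general (S : QuantumMarkovSemigroup H) {k h : H} (hkh : ⟪k, h⟫ ≠ 0)
    (hk : InnerProductSpace.rankOne ℂ k k ∈ S.generator.domain)
    (hbound : ∃ C : ℝ, ∀ (x : H) (hx : x ∈ S.domainVectors k),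
      ‖S.generator ⟨InnerProductSpace.rankOne ℂ x k, S.rankOne_mem_domain hx⟩ h‖ ≤ C * ‖x‖)
    (hdense : Dense (S.domainVectors k)) :
    ∃ 𝒜 : StarSubalgebra ℂ (H →L[ℂ] H), (𝒜 : Set (H →L[ℂ] H)) = S.domainAlgebra ∧
      ∃ (G : H →L[ℂ] H) (K : Type u) (_ : NormedAddCommGroup K) (_ : InnerProductSpace ℂ K)
        (_ : CompleteSpace K) (V : H →L[ℂ] K) (π : 𝒜 →⋆ₐ[ℂ] (K →L[ℂ] K)),
        Continuous π ∧
        (∀ (A : 𝒜) (hA : (A : H →L[ℂ] H) ∈ S.generator.domain),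
          S.generator ⟨A, hA⟩ =
            adjoint V ∘L π A ∘L V + G ∘L (A : H →L[ℂ] H) + (A : H →L[ℂ] H) ∘L adjoint G) ∧
        IsSigmaWeaklyContinuous (𝒟 := (𝒜 : Set (H →L[ℂ] H)))
          (fun A => G ∘L (A : H →L[ℂ] H) + (A : H →L[ℂ] H) ∘L adjoint G) ∧
        IsSigmaWeaklyClosable (𝒟 := (𝒜 : Set (H →L[ℂ] H)))
          (fun A => adjoint V ∘L π A ∘L V) := by
  obtain ⟨C, hC⟩ := hbound
  obtain ⟨G, hG⟩ := S.isConditionallyDilatable_algebraGenerator.exists_isDilatable_sub_driftPart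
    (k := k) hkh hdense (QuantumMarkovSemigroup.self_mem_domainVectors hk) ⟨C, fun x => hC x x.2⟩
  obtain ⟨K, _, _, _, V, π, hπ_norm, hπ⟩ := hG.exists_dilation
  have generator_eq (A : S.domainStarSubalgebra) : S.algebraGenerator A =
      adjoint V ∘L π A ∘L V + (G ∘L (A : H →L[ℂ] H) + (A : H →L[ℂ] H) ∘L adjoint G) := by
    rw [← hπ, LinearMap.sub_apply, driftPart_apply, sub_add_cancel]
  refine ⟨S.domainStarSubalgebra, rfl, G, K, inferInstance, inferInstance, inferInstance, V, π,
    AddMonoidHomClass.continuous_of_bound π 1 fun A => (hπ_norm A).trans_eq (one_mul _).symm,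
    fun A _ => (generator_eq A).trans (add_assoc _ _ _).symm,
    isSigmaWeaklyContinuous_comp_add_comp_adjoint _ G, ?_⟩
  refine IsSigmaWeaklyClosable.of_add_comp_add_comp_adjoint (G := G) ?_
  simpa only [← generator_eq] using! S.isSigmaWeaklyClosable_algebraGenerator

end MainTheorem

theorem IsAssociateVector.inner_apply_self {H : Type u} [NormedAddCommGroup H]
    [InnerProductSpace ℂ H] {R : H →L[ℂ] H} {h : H} (hh : IsAssociateVector R h) (hR : R ≠ 0) :
    ⟪R h, h⟫ = 1 := by
  obtain ⟨m, k', k, t', ho, ht', hRk, hk, hh⟩ := hh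
  set t := ∑ j, t' j with ht
  have t_pos : 0 < t := by
    refine Finset.sum_pos (fun j _ => ht' j) (Finset.univ_nonempty_iff.2 ?_)
    by_contra hm
    rw [not_nonempty_iff] at hm
    exact hR (by rw [hRk, Finset.univ_eq_empty, Finset.sum_empty])
  have norm_sq_k (s : Fin m) : ‖k s‖ ^ 2 = t := by
    rw [hk, norm_smul, ho.1 s, mul_one, Complex.norm_real, Real.norm_of_nonneg (Real.sqrt_nonneg _),
      Real.sq_sqrt t_pos.le]
  have h_eq : h = ∑ s, ((t⁻¹ * √t : ℝ) : ℂ) • k' s := by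
    rw [hh]
    refine Finset.sum_congr rfl fun s _ => ?_
    rw [norm_sq_k, hk, smul_smul]
    push_cast
    rfl
  have inner_h (s : Fin m) : ⟪k' s, h⟫ = ((t⁻¹ * √t : ℝ) : ℂ) := by
    rw [h_eq, ho.inner_right_fintype]
  have coeff_sq : t⁻¹ * √t * (t⁻¹ * √t) = t⁻¹ := by
    rw [mul_mul_mul_comm, Real.mul_self_sqrt t_pos.le, mul_assoc,
      inv_mul_cancel₀ t_pos.ne', mul_one]
  calc ⟪R h, h⟫
      = ∑ s, ((t' s * (t⁻¹ * √t * (t⁻¹ * √t)) : ℝ) : ℂ) := by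
        simp only [hRk, sum_apply, sum_inner, smul_apply, InnerProductSpace.rankOne_apply,
          inner_smul_left, inner_h, Complex.conj_ofReal, ← Complex.ofReal_mul]
    _ = 1 := by
        rw [← Complex.ofReal_sum, ← Finset.sum_mul, coeff_sq, ← ht, mul_inv_cancel₀ t_pos.ne',
          Complex.ofReal_one]

theorem proposition5p2 {H : Type u} [NormedAddCommGroup H] [InnerProductSpace ℂ H]
    [CompleteSpace H] (S : QuantumMarkovSemigroup H)
    (R : H →L[ℂ] H) (hR_pos : R.IsPositive) (hR_fin : FiniteDimensional ℂ R.range) (hR_ne : R ≠ 0)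
    (hR_dom : R ∈ S.generator.domain)
    (h : H) (hh : IsAssociateVector R h)
    (hRh : InnerProductSpace.rankOne ℂ (R h) (R h) ∈ S.generator.domain)
    (hbound : ∃ C : ℝ, 0 < C ∧ ∀ (x : H) (hx : x ∈ S.domainVectors (R h)),
      ‖S.generator ⟨InnerProductSpace.rankOne ℂ x (R h), S.rankOne_mem_domain hx⟩ h‖ ≤ C * ‖x‖)
    (hdense : Dense (S.domainVectors (R h))) :
    ∃ 𝒜 : StarSubalgebra ℂ (H →L[ℂ] H), (𝒜 : Set (H →L[ℂ] H)) = S.domainAlgebra ∧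
      ∃ (G : H →L[ℂ] H) (K : Type u) (_ : NormedAddCommGroup K) (_ : InnerProductSpace ℂ K)
        (_ : CompleteSpace K) (V : H →L[ℂ] K) (π : 𝒜 →⋆ₐ[ℂ] (K →L[ℂ] K)),
        Continuous π ∧
        (∀ (A : 𝒜) (hA : (A : H →L[ℂ] H) ∈ S.generator.domain),
          S.generator ⟨A, hA⟩ =
            adjoint V ∘L π A ∘L V + G ∘L (A : H →L[ℂ] H) + (A : H →L[ℂ] H) ∘L adjoint G) ∧
        IsSigmaWeaklyContinuous (𝒟 := (𝒜 : Set (H →L[ℂ] H)))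
          (fun A => G ∘L (A : H →L[ℂ] H) + (A : H →L[ℂ] H) ∘L adjoint G) ∧
        IsSigmaWeaklyClosable (𝒟 := (𝒜 : Set (H →L[ℂ] H)))
          (fun A => adjoint V ∘L π A ∘L V) := by
  obtain ⟨C, -, hC⟩ := hbound
  exact proposition5p2_general S (hh.inner_apply_self hR_ne ▸ one_ne_zero) hRh ⟨C, hC⟩ hdense
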